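/- **Setting.** An amplify-and-forward network has $K\ge 1$ transmitters, $R\ge 1$ parallel relays, $L\ge 1$ receivers and no direct links. The channels $f_{kr}\sim\mathcal{CN}(0,\sigma^2_{f_{kr}})$ and $g_{r\ell}\sim\mathcal{CN}(0,\sigma^2_{g_{r\ell}})$ are independent with positive finite variances; $h=(f_{kr},g_{r\ell})$. Transmitter $k$ has power $P_{S_k}=p_{S_k}P$ and relay $r$ has power $P_{R_r}=p_{R_r}P$, with fixed $p_{S_k},p_{R_r}\in(0,\infty)$. The symbols $s_k$ are independent and uniform on finite nonempty constellations $\mathcal S_k\subset\mathbb C$ (not all of them singletons) with $\mathrm E|s_k|^2=1$; $\mathscr S=\prod_k\mathcal S_k$. For a beamforming vector $x\in\mathbb C^R$ with $\|x\|_\infty\le 1$, relay $r$ receives $t_r=\sum_k f_{kr}\sqrt{P_{S_k}}\,s_k+\eta_{0r}$ and sends $x_r\sqrt{\rho_r}\,t_r$, where $\rho_r=P_{R_r}/(1+\sum_i|f_{ir}|^2P_{S_i})$; receiver $\ell$ observes $y_\ell=\sum_r g_{r\ell}x_r\sqrt{\rho_r}\,t_r+\eta_{1\ell}$. All noises are independent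 $\mathcal{CN}(0,1)$, and channels, symbols and noises are independent of each other. Receiver $\ell$ decodes $(s_k)_{k\in\mathcal D_\ell}$, where $\mathcal D_\ell\neq\emptyset$ and $\bigcup_\ell\mathcal D_\ell=\{1,\dots,K\}$, by maximizing the a posteriori probability given $y_\ell,x,h$ over $\prod_{k\in\mathcal D_\ell}\mathcal S_k$. Let $\mathrm{CNER}(x,h)$ be the probability, given $h$ and $x$, that at least one receiver decodes incorrectly, and for a quantizer $\mathsf Q:h\mapsto x$ let $\mathrm{NER}(\mathsf Q)=\mathrm E_h[\mathrm{CNER}(\mathsf Q(h),h)]$. Let $$\gamma^{\mathsf L}(x,h)=\min_{\ell}\ \min_{s\ne\hat s\in\mathscr S}\ \frac{\bigl|\sum_{k}(s_k-\hat s_k)\sqrt{P_{S_k}}\sum_{r}f_{kr}\sqrt{\rho_r}\,g_{r\ell}x_r\bigr|^2}{4\bigl(1+\sum_{r}\rho_r|g_{r\ell}|^2|x_r|^2\bigr)}$$ be the network SNR, let $\mathcal C_{\mathsf S}=\{e_1,\dots,e_R\}$ (the standard unit vectors) be the relay-selection codebook, and let $\mathsf{GQ}_{\mathcal C_{\mathsf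 S}}(h)=\arg\max_{e_r\in\mathcal C_{\mathsf S}}\gamma^{\mathsf L}(e_r,h)$. Ties in every $\arg\max$ are broken by a fixed rule that depends only on the set of maximizers. A scheme (a quantizer for each $P$) has diversity $(d_1,d_2)$ if $d_1=\lim_{P\to\infty}-\frac{\log\mathrm{NER}}{\log P}$ and $d_2=\lim_{P\to\infty}-\frac{\log\mathrm{NER}+d_1\log P}{\log\log P}$. Diversities are compared lexicographically. **Theorem.** There are constants $0<C_3,C_4<\infty$ independent of $P$ such that for all sufficiently large $P$ $$\mathrm{NER}(\mathsf{GQ}_{\mathcal C_{\mathsf S}})\le C_3\,\frac{1}{P^R}\quad\text{if }K=1,\qquad \mathrm{NER}(\mathsf{GQ}_{\mathcal C_{\mathsf S}})\le C_4\,\frac{\log^R P}{P^R}\quad\text{if }K>1 .$$ Moreover, $\mathsf{GQ}_{\mathcal C_{\mathsf S}}$ attains the maximal diversity for all $K$ and $L$: its diversity is $(R,0)$ if $K=1$ and $(R,-R)$ if $K>1$, and no scheme whose quantizers take values in $\{x\in\mathbb C^R:\|x\|_\infty\le1\}$ has a higher diversity. The latter includes that no such scheme has a higher first-order diversity $d_1$,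 whether or not its $d_2$ exists. -/

import Mathlib

open MeasureTheory ProbabilityTheory Filter Topology
open scoped NNReal ENNReal BigOperators

noncomputable section

/-- The circularly symmetric complex Gaussian law `CN(0, v)`: real and imaginary parts are
independent real Gaussians with mean `0` and variance `v / 2`, so that `E|z|² = v`. -/
def complexNormal (v : ℝ≥0) : Measure ℂ :=
  ((gaussianReal 0 (v / 2)).prod (gaussianReal 0 (v / 2))).map
    (fun p : ℝ × ℝ => (⟨p.1, p.2⟩ : ℂ))

/-- The density of `CN(m, v)` on `ℂ` with respect to area, for `v > 0`. -/
def complexNormalPDF (m : ℂ) (v : ℝ) (y : ℂ) : ℝ :=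
  (Real.pi * v)⁻¹ * Real.exp (-(‖y - m‖ ^ 2 / v))

/-- `argmax f` is a maximizer of `f`. Ties are broken by a fixed rule: the value depends only on
the set of maximizers. -/
def argmax {ι : Type} [Nonempty ι] (f : ι → ℝ) : ι :=
  Classical.epsilon (fun i => ∀ j, f j ≤ f i)

theorem argmax_spec {ι : Type} [Nonempty ι] [Finite ι] (f : ι → ℝ) (j : ι) :
    f j ≤ f (argmax f) :=
  Classical.epsilon_spec (p := fun i => ∀ j, f j ≤ f i) (Finite.exists_max f) j

/-- The parameters of an amplify-and-forward network with `K` transmitters, `L` receivers and `R`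
parallel relays. -/
structure RelayNetwork (K L R : ℕ) where
  /-- the constellation of each transmitter -/
  S : Fin K → Finset ℂ
  S_nonempty : ∀ k, (S k).Nonempty
  /-- there is something to decode -/
  S_nontrivial : ∃ k, (S k).Nontrivial
  /-- symbols are uniform on the constellation and normalized by `E|s_k|² = 1` -/
  S_energy : ∀ k, (∑ s ∈ S k, ‖s‖ ^ 2) / ((S k).card : ℝ) = 1
  /-- the set of transmitters that each receiver wants to decode -/
  D : Fin L → Finset (Fin K)
  D_nonempty : ∀ l, (D l).Nonempty
  D_cover : ∀ k, ∃ l, k ∈ D l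
  /-- variance of the channel from transmitter `k` to relay `r` -/
  varF : Fin K → Fin R → ℝ≥0
  varF_pos : ∀ k r, 0 < varF k r
  /-- variance of the channel from relay `r` to receiver `l` -/
  varG : Fin R → Fin L → ℝ≥0
  varG_pos : ∀ r l, 0 < varG r l
  /-- transmitter `k` has power `pS k * P` -/
  pS : Fin K → ℝ
  pS_pos : ∀ k, 0 < pS k
  /-- relay `r` has power `pR r * P` -/
  pR : Fin R → ℝ
  pR_pos : ∀ r, 0 < pR r

/-- A channel state `h = (f, g)`. -/
abbrev ChannelState (K L R : ℕ) : Type := (Fin K → Fin R → ℂ) × (Fin R → Fin L → ℂ)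

/-- Noise realizations `(η₀, η₁)` at the relays and at the receivers. -/
abbrev NoiseState (L R : ℕ) : Type := (Fin R → ℂ) × (Fin L → ℂ)

namespace RelayNetwork

variable {K L R : ℕ} (N : RelayNetwork K L R)

/-- Vectors of transmitted symbols, `∏_k S_k`. -/
abbrev Symbols : Type := (k : Fin K) → ↥(N.S k)

/-- Super-symbols relevant to receiver `l`, `∏_{k ∈ D_l} S_k`. -/
abbrev SuperSymbol (l : Fin L) : Type := (k : ↥(N.D l)) → ↥(N.S k)

/-- The super-symbol of receiver `l` in a vector of transmitted symbols. -/
def desired (l : Fin L) (s : N.Symbols) : N.SuperSymbol l := fun k => s k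

instance (l : Fin L) : Nonempty (N.SuperSymbol l) :=
  ⟨fun k => ⟨_, (N.S_nonempty k).choose_spec⟩⟩

/-- The law of the channel state: independent entries, `f_{kr} ~ CN(0, varF k r)` and
`g_{rl} ~ CN(0, varG r l)`. -/
def channelLaw : Measure (ChannelState K L R) :=
  (Measure.pi fun k => Measure.pi fun r => complexNormal (N.varF k r)).prod
    (Measure.pi fun r => Measure.pi fun l => complexNormal (N.varG r l))

/-- The law of the noises: all of them independent and `CN(0, 1)`. -/
def noiseLaw (L R : ℕ) : Measure (NoiseState L R) :=
  (Measure.pi fun _ : Fin R => complexNormal 1).prod (Measure.pi fun _ : Fin L => complexNormal 1)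

/-- Relay normalization factor `ρ_r`. -/
def rho (P : ℝ) (h : ChannelState K L R) (r : Fin R) : ℝ :=
  (N.pR r * P) / (1 + ∑ i, ‖h.1 i r‖ ^ 2 * (N.pS i * P))

/-- First step: the signal `t_r` received by relay `r`. -/
def relayReceived (P : ℝ) (h : ChannelState K L R) (s : N.Symbols) (η : NoiseState L R)
    (r : Fin R) : ℂ :=
  (∑ k, h.1 k r * (s k : ℂ) * (Real.sqrt (N.pS k * P) : ℂ)) + η.1 r

/-- Second step: the signal `u_r` sent by relay `r` under the beamforming vector `x`. -/
def relayTransmitted (P : ℝ) (x : Fin R → ℂ) (h : ChannelState K L R) (s : N.Symbols)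
    (η : NoiseState L R) (r : Fin R) : ℂ :=
  x r * (Real.sqrt (N.rho P h r) : ℂ) * N.relayReceived P h s η r

/-- The signal `y_l` received by receiver `l`. -/
def received (P : ℝ) (x : Fin R → ℂ) (h : ChannelState K L R) (s : N.Symbols)
    (η : NoiseState L R) (l : Fin L) : ℂ :=
  (∑ r, h.2 r l * N.relayTransmitted P x h s η r) + η.2 l

/-- The mean of `y_l` given the transmitted symbols. -/
def signalMean (P : ℝ) (x : Fin R → ℂ) (h : ChannelState K L R) (s : N.Symbols)
    (l : Fin L) : ℂ :=
  ∑ k, ∑ r, x r * (Real.sqrt (N.rho P h r) : ℂ) * h.1 k r * h.2 r l *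
    (Real.sqrt (N.pS k * P) : ℂ) * (s k : ℂ)

/-- The variance of the total noise in `y_l`. -/
def noiseVar (P : ℝ) (x : Fin R → ℂ) (h : ChannelState K L R) (l : Fin L) : ℝ :=
  1 + ∑ r, N.rho P h r * ‖h.2 r l‖ ^ 2 * ‖x r‖ ^ 2

open Classical in
/-- The a posteriori probability `P(t | y_l = y, x, h)` of the super-symbol `t` at receiver `l`,
by Bayes' rule: the prior is uniform, and `y_l` given the transmitted symbols is complex normal. -/
def posterior (P : ℝ) (x : Fin R → ℂ) (h : ChannelState K L R) (l : Fin L) (y : ℂ)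
    (t : N.SuperSymbol l) : ℝ :=
  (∑ s : N.Symbols with N.desired l s = t, (Fintype.card N.Symbols : ℝ)⁻¹ *
      complexNormalPDF (N.signalMean P x h s l) (N.noiseVar P x h l) y) /
    (∑ s : N.Symbols, (Fintype.card N.Symbols : ℝ)⁻¹ *
      complexNormalPDF (N.signalMean P x h s l) (N.noiseVar P x h l) y)

/-- The individual maximum likelihood decoder of receiver `l`. -/
def decode (P : ℝ) (x : Fin R → ℂ) (h : ChannelState K L R) (l : Fin L) (y : ℂ) :
    N.SuperSymbol l :=
  argmax (N.posterior P x h l y)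

/-- Conditional network error rate: the probability, over uniform transmitted symbols and the
noises, that at least one receiver decodes its desired super-symbol incorrectly. -/
def CNER (P : ℝ) (x : Fin R → ℂ) (h : ChannelState K L R) : ℝ≥0∞ :=
  (∑ s : N.Symbols, noiseLaw L R
      {η | ∃ l, N.decode P x h l (N.received P x h s η l) ≠ N.desired l s}) /
    (Fintype.card N.Symbols : ℝ≥0∞)

/-- Network error rate of the quantizer `Q`: the expectation of `CNER (Q h) h` over the channel
state `h`. -/
def NER (P : ℝ) (Q : ChannelState K L R → (Fin R → ℂ)) : ℝ :=
  (∫⁻ h, N.CNER P (Q h) h ∂N.channelLaw).toReal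

/-- Pairwise signal-to-noise ratio `γ_{l,s,s'}(x, h)`. -/
def pairSNR (P : ℝ) (x : Fin R → ℂ) (h : ChannelState K L R) (l : Fin L)
    (s s' : N.Symbols) : ℝ :=
  ‖∑ k, ((s k : ℂ) - (s' k : ℂ)) * (Real.sqrt (N.pS k * P) : ℂ) *
      ∑ r, h.1 k r * (Real.sqrt (N.rho P h r) : ℂ) * h.2 r l * x r‖ ^ 2 /
    (4 * (1 + ∑ r, N.rho P h r * ‖h.2 r l‖ ^ 2 * ‖x r‖ ^ 2))

/-- Network signal-to-noise ratio `γ^L(x, h)`: the minimum of the pairwise ratios over all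
receivers and all pairs of distinct symbol vectors (finitely many, and at least one). -/
def networkSNR (P : ℝ) (x : Fin R → ℂ) (h : ChannelState K L R) : ℝ :=
  ⨅ l : Fin L, ⨅ p : {p : N.Symbols × N.Symbols // p.1 ≠ p.2}, N.pairSNR P x h l p.1.1 p.1.2

/-- The relay selection vector `e_r`. The relay selection codebook is `{e_r : r}`. -/
def relayVector (r : Fin R) : Fin R → ℂ := Pi.single r 1

/-- The global quantizer with the relay selection codebook that maximizes the network SNR. -/
def GQ [NeZero R] (P : ℝ) (h : ChannelState K L R) : Fin R → ℂ :=
  relayVector (argmax fun r : Fin R => N.networkSNR P (relayVector r) h)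

end RelayNetwork

/-- `d₁` is the first-order diversity of the error rate `e`, a function of the power `P`. -/
def HasFirstOrderDiversity (e : ℝ → ℝ) (d₁ : ℝ) : Prop :=
  Tendsto (fun P => -(Real.log (e P) / Real.log P)) atTop (𝓝 d₁)

/-- `d₂` is the second-order diversity of an error rate `e` of first-order diversity `d₁`. -/
def HasSecondOrderDiversity (e : ℝ → ℝ) (d₁ d₂ : ℝ) : Prop :=
  Tendsto (fun P => -((Real.log (e P) + d₁ * Real.log P) / Real.log (Real.log P))) atTop (𝓝 d₂)

/-- The scheme `Q` (one quantizer for each `P`) has diversity `(d₁, d₂)`, and no scheme with values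
in the set `{x : ‖x‖_∞ ≤ 1}` of all beamforming vectors has a higher one (lexicographically). -/
def RelayNetwork.AttainsMaximalDiversity {K L R : ℕ} (N : RelayNetwork K L R)
    (Q : ℝ → ChannelState K L R → (Fin R → ℂ)) (d₁ d₂ : ℝ) : Prop :=
  HasFirstOrderDiversity (fun P => N.NER P (Q P)) d₁ ∧
  HasSecondOrderDiversity (fun P => N.NER P (Q P)) d₁ d₂ ∧
  ∀ Q' : ℝ → ChannelState K L R → (Fin R → ℂ), (∀ P h, ‖Q' P h‖ ≤ 1) →
    ∀ d₁' : ℝ, HasFirstOrderDiversity (fun P => N.NER P (Q' P)) d₁' →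
      d₁' ≤ d₁ ∧
      (d₁' = d₁ → ∀ d₂' : ℝ, HasSecondOrderDiversity (fun P => N.NER P (Q' P)) d₁' d₂' →
        d₂' ≤ d₂)

end

/-! The error rate is bounded on both sides by constant multiples of `ε P ^ R`, with `ε P = 1 / P`
for `K = 1` and `ε P = log P / P` for `K > 1`; both diversities then follow by squeezing.

Upper bound. A union bound and the Bhattacharyya bound give a conditional error rate of at most `C
exp(-γ)`, with `γ` the network SNR (`exists_CNER_le`). Under relay selection `γ` is the largest of
the single-relay values `γ_r`, so `exp(-γ) ≤ ∏ r, exp(-γ_r / R)`. As `γ_r` involves only the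
channels of relay `r`, the expectation of the product factorizes (`exists_NER_GQ_le`), and the law
of a maximum is never needed. For `K = 1`, `γ_r` behaves like the minimum of two exponential
variables with means of order `P`, and its factor is of order `1 / P`. For `K > 1`, the combination
`∑ d_k f_k` in the numerator can nearly vanish while the power `F` of all `f_k` in the denominator
does not. Averaging over `g` leaves `(1 + F) / (1 + c P U)` with `U` the squared modulus of a
complex Gaussian, whose mean is of order `log P / P`.

Lower bound. Take two symbol vectors that differ in one desired symbol. If every relay is weak
(`weakRelay`), their means at the receiver differ by at most the noise standard deviation, for every
beamforming vector in the unit ball, so no quantizer keeps the conditional error rate below a fixed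
constant. A relay is weak with probability at least of order `1 / P`, because `f_k` may fade. For `K
> 1` a second, unfaded transmitter caps the relay gain, and `|f_k|² |g_l|²` of order `1 / P`
suffices, which has probability of order `log P / P`. Independence of the relays gives the power
`R`. -/

noncomputable section

/-! ### Complex Gaussian laws: densities, linear combinations, expectations -/

instance isProbabilityMeasure_complexNormal (v : ℝ≥0) :
    IsProbabilityMeasure (complexNormal v) := by
  unfold complexNormal
  exact Measure.isProbabilityMeasure_map
    Complex.measurableEquivRealProd.symm.measurable.aemeasurable

theorem complexNormalPDF_nonneg {v : ℝ} (hv : 0 ≤ v) (m y : ℂ) : 0 ≤ complexNormalPDF m v y := by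
  unfold complexNormalPDF; positivity

theorem complexNormalPDF_pos {v : ℝ} (hv : 0 < v) (m y : ℂ) : 0 < complexNormalPDF m v y := by
  unfold complexNormalPDF; positivity

theorem continuous_complexNormalPDF (m : ℂ) (v : ℝ) : Continuous (complexNormalPDF m v) := by
  unfold complexNormalPDF; fun_prop

theorem complexNormal_eq_withDensity {v : ℝ≥0} (hv : 0 < v) :
    complexNormal v =
      (volume : Measure ℂ).withDensity (fun z => ENNReal.ofReal (complexNormalPDF 0 v z)) := by
  have hv2 : v / 2 ≠ 0 := by positivity
  unfold complexNormal
  rw [gaussianReal_of_var_ne_zero _ hv2,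
    prod_withDensity (measurable_gaussianPDF _ _) (measurable_gaussianPDF _ _)]
  ext s hs
  have hmeas : Measurable (fun p : ℝ × ℝ => (⟨p.1, p.2⟩ : ℂ)) :=
    Complex.measurableEquivRealProd.symm.measurable
  rw [Measure.map_apply hmeas hs, withDensity_apply _ (hmeas hs), withDensity_apply _ hs,
    ← (Complex.volume_preserving_equiv_real_prod.symm).setLIntegral_comp_preimage_emb
      Complex.measurableEquivRealProd.symm.measurableEmbedding]
  refine setLIntegral_congr_fun (hmeas hs) fun p _ => ?_
  have hvr : (0 : ℝ) < v := by exact_mod_cast hv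
  simp only [gaussianPDF, Complex.measurableEquivRealProd_symm_apply]
  rw [← ENNReal.ofReal_mul (gaussianPDFReal_nonneg _ _ _)]
  congr 1
  simp only [gaussianPDFReal, complexNormalPDF, sub_zero, ← Complex.normSq_eq_norm_sq,
    Complex.normSq_apply]
  have h1 : (2 : ℝ) * Real.pi * ((v / 2 : ℝ≥0) : ℝ) = Real.pi * v := by push_cast; ring
  rw [h1, mul_mul_mul_comm, ← Real.exp_add, ← mul_inv, Real.mul_self_sqrt (by positivity)]
  congr 2
  push_cast
  field_simp
  ring

theorem charFun_complexNormal (v : ℝ≥0) (t : ℂ) :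
    charFun (complexNormal v) t = Complex.exp (-(v * ‖t‖ ^ 2 / 4 : ℝ)) := by
  have hmeas : Measurable (fun p : ℝ × ℝ => (⟨p.1, p.2⟩ : ℂ)) :=
    Complex.measurableEquivRealProd.symm.measurable
  rw [charFun_apply, complexNormal, integral_map hmeas.aemeasurable
    (by fun_prop)]
  have h : ∀ p : ℝ × ℝ, Complex.exp ((inner ℝ (⟨p.1, p.2⟩ : ℂ) t : ℝ) * Complex.I) =
      Complex.exp ((inner ℝ p.1 t.re : ℝ) * Complex.I) *
        Complex.exp ((inner ℝ p.2 t.im : ℝ) * Complex.I) := by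
    intro p
    rw [← Complex.exp_add, ← add_mul]
    congr 2
    rw [← Complex.ofReal_add]
    congr 1
    simp [Complex.inner]
  simp_rw [h]
  rw [integral_prod_mul (fun x : ℝ => Complex.exp ((inner ℝ x t.re : ℝ) * Complex.I))
    (fun x : ℝ => Complex.exp ((inner ℝ x t.im : ℝ) * Complex.I)), ← charFun_apply,
    ← charFun_apply, charFun_gaussianReal, charFun_gaussianReal, ← Complex.exp_add]
  congr 1
  rw [← Complex.normSq_eq_norm_sq, Complex.normSq_apply]
  push_cast
  ring

/-- The characteristic function of a sum of independent terms is a product. This serves both the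
noise forwarded by the relays and the difference signal `∑ d_k f_k`. -/
theorem map_linearCombination_complexNormal {ι : Type*} [Fintype ι] (v : ι → ℝ≥0) (a : ι → ℂ) :
    (Measure.pi fun i => complexNormal (v i)).map (fun z => ∑ i, a i * z i) =
      complexNormal (∑ i, ‖a i‖₊ ^ 2 * v i) := by
  have hmeas : Measurable (fun z : ι → ℂ => ∑ i, a i * z i) := by fun_prop
  have : IsProbabilityMeasure
      ((Measure.pi fun i => complexNormal (v i)).map (fun z => ∑ i, a i * z i)) :=
    Measure.isProbabilityMeasure_map hmeas.aemeasurable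
  refine Measure.ext_of_charFun ?_
  ext t
  rw [charFun_apply, integral_map hmeas.aemeasurable (by fun_prop)]
  have h : ∀ z : ι → ℂ, Complex.exp ((inner ℝ (∑ i, a i * z i) t : ℝ) * Complex.I) =
      ∏ i, Complex.exp ((inner ℝ (z i) (starRingEnd ℂ (a i) * t) : ℝ) * Complex.I) := by
    intro z
    rw [← Complex.exp_sum, sum_inner, ← Finset.sum_mul, Complex.ofReal_sum]
    congr 2
    refine Finset.sum_congr rfl fun i _ => ?_
    simp only [Complex.inner, map_mul]
    congr 2
    ring
  simp_rw [h]
  rw [integral_fintype_prod_eq_prod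
    (f := fun i z => Complex.exp ((inner ℝ z (starRingEnd ℂ (a i) * t) : ℝ) * Complex.I))]
  simp_rw [← charFun_apply, charFun_complexNormal, ← Complex.exp_sum]
  congr 1
  push_cast
  simp only [norm_mul, RCLike.norm_conj, Finset.sum_mul, Finset.sum_div, Finset.sum_neg_distrib,
    Complex.ofReal_mul, neg_inj]
  refine Finset.sum_congr rfl fun i _ => ?_
  ring

theorem conv_complexNormal (v w : ℝ≥0) :
    (complexNormal v).conv (complexNormal w) = complexNormal (v + w) := by
  refine Measure.ext_of_charFun ?_
  ext t
  rw [charFun_conv]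
  simp_rw [charFun_complexNormal, ← Complex.exp_add]
  congr 1
  push_cast
  ring

/-- A complex Gaussian translated by `m` has the density `complexNormalPDF m v`. -/
theorem map_const_add_complexNormal {v : ℝ≥0} (hv : 0 < v) (m : ℂ) :
    (complexNormal v).map (fun z => m + z) =
      (volume : Measure ℂ).withDensity (fun z => ENNReal.ofReal (complexNormalPDF m v z)) := by
  rw [complexNormal_eq_withDensity hv]
  ext s hs
  have hm : Measurable (fun z : ℂ => m + z) := by fun_prop
  rw [Measure.map_apply hm hs, withDensity_apply _ (hm hs), withDensity_apply _ hs,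
    ← (measurePreserving_add_left volume m).setLIntegral_comp_preimage_emb
      (measurableEmbedding_addLeft m)
      (fun z => ENNReal.ofReal (complexNormalPDF m v z)) s]
  refine setLIntegral_congr_fun (hm hs) fun z _ => ?_
  simp [complexNormalPDF]

theorem lintegral_complexNormalPDF {v : ℝ} (hv : 0 < v) (m : ℂ) :
    ∫⁻ z, ENNReal.ofReal (complexNormalPDF m v z) = 1 := by
  lift v to ℝ≥0 using hv.le
  have h := map_const_add_complexNormal (v := v) (by exact_mod_cast hv) m
  have h1 := congrArg (fun μ => μ Set.univ) h
  simp only [withDensity_apply _ MeasurableSet.univ, Measure.restrict_univ] at h1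
  rw [Measure.map_apply (by fun_prop) MeasurableSet.univ] at h1
  simpa using h1.symm

theorem lintegral_complexNormal {v : ℝ≥0} (hv : 0 < v) {φ : ℂ → ℝ≥0∞} (hφ : Measurable φ) :
    ∫⁻ z, φ z ∂complexNormal v = ∫⁻ z, ENNReal.ofReal (complexNormalPDF 0 v z) * φ z := by
  rw [complexNormal_eq_withDensity hv, lintegral_withDensity_eq_lintegral_mul _
    (continuous_complexNormalPDF 0 v).measurable.ennreal_ofReal hφ]
  rfl

/-- The Laplace transform of the squared modulus of a complex Gaussian. -/
theorem lintegral_exp_neg_mul_sq_complexNormal {v : ℝ≥0} (hv : 0 < v) {t : ℝ} (ht : 0 ≤ t) :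
    ∫⁻ z, ENNReal.ofReal (Real.exp (-(t * ‖z‖ ^ 2))) ∂complexNormal v =
      ENNReal.ofReal (1 / (1 + t * v)) := by
  have hvr : (0 : ℝ) < v := by exact_mod_cast hv
  rw [lintegral_complexNormal hv (by fun_prop)]
  have hw : 0 < (v : ℝ) / (1 + t * v) := by positivity
  -- Tilting a Gaussian by `exp(-t|z|²)` gives a Gaussian of variance `v / (1 + t v)`; the factor is
  -- the ratio of the normalizations.
  have h : ∀ z : ℂ, ENNReal.ofReal (complexNormalPDF 0 v z) *
      ENNReal.ofReal (Real.exp (-(t * ‖z‖ ^ 2))) =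
      ENNReal.ofReal (1 / (1 + t * v)) *
        ENNReal.ofReal (complexNormalPDF 0 (v / (1 + t * v)) z) := by
    intro z
    rw [← ENNReal.ofReal_mul (complexNormalPDF_nonneg hvr.le _ _),
      ← ENNReal.ofReal_mul (by positivity)]
    congr 1
    simp only [complexNormalPDF, sub_zero]
    rw [mul_assoc, ← Real.exp_add, ← mul_assoc]
    congr 1
    · field_simp
    · congr 1
      field_simp
      ring
  simp_rw [h]
  rw [lintegral_const_mul _ (continuous_complexNormalPDF _ _).measurable.ennreal_ofReal,
    lintegral_complexNormalPDF hw, mul_one]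

/-- Integration of radial functions on `ℂ`. -/
theorem lintegral_comp_norm_complex {φ : ℝ → ℝ≥0∞} (hφ : Measurable φ) :
    ∫⁻ z : ℂ, φ ‖z‖ =
      ENNReal.ofReal (2 * Real.pi) * ∫⁻ r in Set.Ioi (0 : ℝ), ENNReal.ofReal r * φ r := by
  rw [← Complex.lintegral_comp_polarCoord_symm]
  have h : ∀ p ∈ polarCoord.target, ENNReal.ofReal p.1 • φ ‖Complex.polarCoord.symm p‖ =
      (ENNReal.ofReal p.1 * φ p.1) * 1 := by
    intro p hp
    have : 0 < p.1 := hp.1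
    rw [Complex.norm_polarCoord_symm, abs_of_pos this, mul_one, smul_eq_mul]
  refine (setLIntegral_congr_fun polarCoord.open_target.measurableSet h).trans ?_
  show ∫⁻ p in Set.Ioi (0 : ℝ) ×ˢ Set.Ioo (-Real.pi) Real.pi, _ = _
  rw [Measure.volume_eq_prod, ← Measure.prod_restrict,
    lintegral_prod_mul (f := fun r : ℝ => ENNReal.ofReal r * φ r) (g := fun _ => 1)
      (by fun_prop) (by fun_prop)]
  simp only [lintegral_const, one_mul, Measure.restrict_apply, MeasurableSet.univ, Set.univ_inter,
    Real.volume_Ioo]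
  rw [mul_comm]
  congr 2
  ring

theorem complexNormalPDF_le {v : ℝ} (hv : 0 < v) (m z : ℂ) :
    complexNormalPDF m v z ≤ (Real.pi * v)⁻¹ := by
  unfold complexNormalPDF
  refine mul_le_of_le_one_right (by positivity) (Real.exp_le_one_iff.2 ?_)
  have : 0 ≤ ‖z - m‖ ^ 2 / v := by positivity
  linarith

theorem le_complexNormalPDF {v a : ℝ} (hv : 0 < v) {m z : ℂ} (h : ‖z - m‖ ^ 2 ≤ a * v) :
    (Real.pi * v)⁻¹ * Real.exp (-a) ≤ complexNormalPDF m v z := by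
  unfold complexNormalPDF
  gcongr
  rwa [div_le_iff₀ hv]

theorem lintegral_Ioc_ofReal_eq_sub {F f : ℝ → ℝ} {a b : ℝ} (hab : a ≤ b)
    (hF : ∀ x ∈ Set.Icc a b, HasDerivAt F (f x) x) (hf : ContinuousOn f (Set.Icc a b))
    (h0 : ∀ x ∈ Set.Ioc a b, 0 ≤ f x) :
    ∫⁻ x in Set.Ioc a b, ENNReal.ofReal (f x) = ENNReal.ofReal (F b - F a) := by
  rw [← Set.uIcc_of_le hab] at hF hf
  have hi : IntervalIntegrable f volume a b := hf.intervalIntegrable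
  rw [← intervalIntegral.integral_eq_sub_of_hasDerivAt hF hi,
    intervalIntegral.integral_of_le hab, ofReal_integral_eq_lintegral_ofReal hi.1]
  exact (ae_restrict_iff' measurableSet_Ioc).2 (ae_of_all _ h0)

/-- The source of the logarithm in the upper bound. In the unit disc the density is at most `1 / (π
v)` and the radial integral of `r / (1 + c r²)` is `log (1 + c) / (2 c)`; outside it the integrand
is at most `1 / c`. -/
theorem lintegral_inv_one_add_mul_sq_complexNormal_le {v : ℝ≥0} (hv : 0 < v) {c : ℝ}
    (hc : 0 < c) :
    ∫⁻ z, ENNReal.ofReal (1 / (1 + c * ‖z‖ ^ 2)) ∂complexNormal v ≤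
      ENNReal.ofReal ((Real.log (1 + c) / v + 1) / c) := by
  have hvr : (0 : ℝ) < v := by exact_mod_cast hv
  rw [lintegral_complexNormal hv (by fun_prop)]
  set ψ : ℝ → ℝ≥0∞ := (Set.Iic (1 : ℝ)).indicator
    fun r => ENNReal.ofReal (1 / (1 + c * r ^ 2)) with hψ
  have hψm : Measurable ψ := by
    refine Measurable.indicator ?_ measurableSet_Iic
    fun_prop
  have hpt : ∀ z : ℂ, ENNReal.ofReal (complexNormalPDF 0 v z) *
      ENNReal.ofReal (1 / (1 + c * ‖z‖ ^ 2)) ≤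
      ENNReal.ofReal (Real.pi * v)⁻¹ * ψ ‖z‖ +
        ENNReal.ofReal (1 / c) * ENNReal.ofReal (complexNormalPDF 0 v z) := by
    intro z
    by_cases hz : ‖z‖ ≤ 1
    · rw [hψ, Set.indicator_of_mem (by exact hz)]
      refine le_add_right ?_
      gcongr
      exact complexNormalPDF_le hvr 0 z
    · refine le_add_left ?_
      rw [mul_comm]
      gcongr
      have : 1 ≤ ‖z‖ ^ 2 := by nlinarith
      nlinarith
  refine (lintegral_mono hpt).trans ?_
  rw [lintegral_add_left (by fun_prop), lintegral_const_mul _ (by fun_prop),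
    lintegral_const_mul _ (continuous_complexNormalPDF 0 v).measurable.ennreal_ofReal,
    lintegral_complexNormalPDF hvr, lintegral_comp_norm_complex hψm]
  have hint : ∫⁻ r in Set.Ioi (0 : ℝ), ENNReal.ofReal r * ψ r =
      ENNReal.ofReal (Real.log (1 + c) / (2 * c)) := by
    have h1 : ∀ r : ℝ, ENNReal.ofReal r * ψ r = (Set.Iic (1 : ℝ)).indicator
        (fun r => ENNReal.ofReal (r / (1 + c * r ^ 2))) r := by
      intro r
      by_cases hr : r ∈ Set.Iic (1 : ℝ)
      · rw [hψ, Set.indicator_of_mem hr, Set.indicator_of_mem hr,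
          ← ENNReal.ofReal_mul' (by positivity), mul_one_div]
      · rw [hψ, Set.indicator_of_notMem hr, Set.indicator_of_notMem hr, mul_zero]
    simp_rw [h1]
    rw [lintegral_indicator measurableSet_Iic, Measure.restrict_restrict measurableSet_Iic,
      Set.inter_comm, Set.Ioi_inter_Iic,
      lintegral_Ioc_ofReal_eq_sub (F := fun r => Real.log (1 + c * r ^ 2) / (2 * c)) zero_le_one]
    · simp
    · intro x _
      have hx : 1 + c * x ^ 2 ≠ 0 := by positivity
      have h2 : HasDerivAt (fun r : ℝ => 1 + c * r ^ 2) (c * (2 * x)) x := by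
        simpa using ((hasDerivAt_pow 2 x).const_mul c).const_add 1
      refine ((h2.log hx).div_const (2 * c)).congr_deriv ?_
      field_simp
    · refine ContinuousOn.div (by fun_prop) (by fun_prop) fun x _ => by positivity
    · intro x hx
      have := hx.1
      positivity
  rw [hint, ← ENNReal.ofReal_mul (by positivity), ← ENNReal.ofReal_mul (by positivity), mul_one,
    ← ENNReal.ofReal_add (mul_nonneg (by positivity) (mul_nonneg (by positivity)
      (div_nonneg (Real.log_nonneg (by linarith)) (by positivity)))) (by positivity)]
  refine ENNReal.ofReal_le_ofReal (le_of_eq ?_)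
  have := Real.pi_pos
  field_simp

/-- The source of the logarithm in the lower bound: on the annulus `√t < |z| ≤ 1` the density is
bounded below, and `t / r` integrates to `t log (1 / t) / 2`. -/
theorem le_lintegral_min_one_div_sq_complexNormal {v : ℝ≥0} (hv : 0 < v) {t : ℝ} (ht : 0 < t)
    (ht1 : t ≤ 1) :
    ENNReal.ofReal (Real.exp (-(1 / v)) / v * (t * Real.log (1 / t))) ≤
      ∫⁻ z, ENNReal.ofReal (min 1 (t / ‖z‖ ^ 2)) ∂complexNormal v := by
  have hvr : (0 : ℝ) < v := by exact_mod_cast hv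
  rw [lintegral_complexNormal hv (by fun_prop)]
  set ψ : ℝ → ℝ≥0∞ := (Set.Ioc (√t) (1 : ℝ)).indicator
    fun r => ENNReal.ofReal (t / r ^ 2) with hψ
  have hψm : Measurable ψ := by
    refine Measurable.indicator ?_ measurableSet_Ioc
    fun_prop
  have hst : 0 < √t := Real.sqrt_pos.2 ht
  have hpt : ∀ z : ℂ, ENNReal.ofReal ((Real.pi * v)⁻¹ * Real.exp (-(1 / v))) * ψ ‖z‖ ≤
      ENNReal.ofReal (complexNormalPDF 0 v z) * ENNReal.ofReal (min 1 (t / ‖z‖ ^ 2)) := by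
    intro z
    by_cases hz : ‖z‖ ∈ Set.Ioc (√t) 1
    · rw [hψ, Set.indicator_of_mem hz]
      have hz0 : 0 < ‖z‖ := hst.trans hz.1
      have h2 : t ≤ ‖z‖ ^ 2 := (Real.sqrt_le_left hz0.le).1 hz.1.le
      gcongr
      · refine le_complexNormalPDF hvr ?_
        rw [sub_zero, one_div_mul_cancel hvr.ne']
        nlinarith [hz.2]
      · exact le_min (by rw [div_le_one (by positivity)]; exact h2) le_rfl
    · rw [hψ, Set.indicator_of_notMem hz, mul_zero]
      exact zero_le
  refine le_trans ?_ (lintegral_mono hpt)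
  rw [lintegral_const_mul _ (by fun_prop), lintegral_comp_norm_complex hψm]
  have hint : ∫⁻ r in Set.Ioi (0 : ℝ), ENNReal.ofReal r * ψ r =
      ENNReal.ofReal (t * Real.log (1 / t) / 2) := by
    have h1 : ∀ r : ℝ, ENNReal.ofReal r * ψ r = (Set.Ioc (√t) (1 : ℝ)).indicator
        (fun r => ENNReal.ofReal (t / r)) r := by
      intro r
      by_cases hr : r ∈ Set.Ioc (√t) (1 : ℝ)
      · have hr0 : 0 < r := hst.trans hr.1
        rw [hψ, Set.indicator_of_mem hr, Set.indicator_of_mem hr, ← ENNReal.ofReal_mul hr0.le]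
        congr 1
        field_simp
      · rw [hψ, Set.indicator_of_notMem hr, Set.indicator_of_notMem hr, mul_zero]
    simp_rw [h1]
    rw [lintegral_indicator measurableSet_Ioc, Measure.restrict_restrict measurableSet_Ioc,
      Set.inter_eq_left.2 (show Set.Ioc (√t) 1 ⊆ Set.Ioi 0 from fun r hr => hst.trans hr.1),
      lintegral_Ioc_ofReal_eq_sub (F := fun r => t * Real.log r) (Real.sqrt_le_one.2 ht1)]
    · rw [Real.log_sqrt ht.le, Real.log_one, one_div, Real.log_inv]
      congr 1
      ring
    · intro x hx
      exact (Real.hasDerivAt_log (hst.trans_le hx.1).ne').const_mul t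
    · refine ContinuousOn.div (by fun_prop) (by fun_prop) fun x hx => (hst.trans_le hx.1).ne'
    · intro x hx
      have := hst.trans hx.1
      positivity
  have hlog : 0 ≤ Real.log (1 / t) := Real.log_nonneg (by rw [le_div_iff₀ ht]; linarith)
  rw [hint, ← ENNReal.ofReal_mul (by positivity), ← ENNReal.ofReal_mul (by positivity)]
  refine ENNReal.ofReal_le_ofReal (le_of_eq ?_)
  have := Real.pi_pos
  field_simp

/-- Truncating at `1` keeps the disc where the density is bounded below, so the mass is at least
proportional to the area. -/
theorem le_complexNormal_closedBall {v : ℝ≥0} (hv : 0 < v) {t : ℝ} (ht : 0 ≤ t) :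
    ENNReal.ofReal (Real.exp (-(1 / v)) / v * min 1 t) ≤
      complexNormal v {z | ‖z‖ ^ 2 ≤ t} := by
  have hvr : (0 : ℝ) < v := by exact_mod_cast hv
  have hm : 0 ≤ min 1 t := le_min zero_le_one ht
  have hsub : Metric.closedBall (0 : ℂ) (√(min 1 t)) ⊆ {z | ‖z‖ ^ 2 ≤ t} := by
    intro z hz
    rw [mem_closedBall_zero_iff] at hz
    exact ((Real.le_sqrt (norm_nonneg _) hm).1 hz).trans (min_le_right _ _)
  refine le_trans ?_ (measure_mono hsub)
  rw [complexNormal_eq_withDensity hv, withDensity_apply _ Metric.isClosed_closedBall.measurableSet]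
  have hpt : ∀ z ∈ Metric.closedBall (0 : ℂ) (√(min 1 t)),
      ENNReal.ofReal ((Real.pi * v)⁻¹ * Real.exp (-(1 / v))) ≤
        ENNReal.ofReal (complexNormalPDF 0 v z) := by
    intro z hz
    rw [mem_closedBall_zero_iff] at hz
    have := ((Real.le_sqrt (norm_nonneg _) hm).1 hz).trans (min_le_left _ _)
    refine ENNReal.ofReal_le_ofReal (le_complexNormalPDF hvr ?_)
    rwa [sub_zero, one_div_mul_cancel hvr.ne']
  refine le_trans ?_ (setLIntegral_mono' Metric.isClosed_closedBall.measurableSet hpt)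
  rw [setLIntegral_const, Complex.volume_closedBall, ← ENNReal.ofReal_pow (Real.sqrt_nonneg _),
    Real.sq_sqrt hm, ← ENNReal.ofReal_coe_nnreal, ← ENNReal.ofReal_mul hm,
    ← ENNReal.ofReal_mul (by positivity)]
  refine ENNReal.ofReal_le_ofReal (le_of_eq ?_)
  have := Real.pi_pos
  simp only [NNReal.coe_real_pi]
  field_simp

theorem complexNormal_one_le_norm_pos {v : ℝ≥0} (hv : 0 < v) :
    0 < complexNormal v {z | 1 ≤ ‖z‖} := by
  have hvr : (0 : ℝ) < v := by exact_mod_cast hv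
  have hs : MeasurableSet {z : ℂ | 1 ≤ ‖z‖} := measurableSet_le measurable_const measurable_norm
  rw [complexNormal_eq_withDensity hv, pos_iff_ne_zero, Ne,
    withDensity_apply_eq_zero (continuous_complexNormalPDF 0 v).measurable.ennreal_ofReal]
  intro h
  have hsub : Metric.ball (2 : ℂ) 1 ⊆
      {z | ENNReal.ofReal (complexNormalPDF 0 v z) ≠ 0} ∩ {z | 1 ≤ ‖z‖} := by
    intro z hz
    refine ⟨by simpa using complexNormalPDF_pos hvr 0 z, ?_⟩
    rw [Metric.mem_ball, dist_eq_norm] at hz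
    have h1 := norm_sub_norm_le (2 : ℂ) z
    rw [norm_sub_rev] at h1
    have : ‖(2 : ℂ)‖ = 2 := by simp
    show 1 ≤ ‖z‖
    linarith
  exact (Metric.measure_ball_pos volume (2 : ℂ) one_pos).ne' (measure_mono_null hsub h)

/-! ### Product measures and polynomial weights -/

theorem lintegral_pi_prod {ι : Type*} [Fintype ι] {X : ι → Type*} [∀ i, MeasurableSpace (X i)]
    (μ : (i : ι) → Measure (X i)) [∀ i, IsProbabilityMeasure (μ i)] {f : (i : ι) → X i → ℝ≥0∞}
    (hf : ∀ i, Measurable (f i)) :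
    ∫⁻ z, ∏ i, f i (z i) ∂Measure.pi μ = ∏ i, ∫⁻ z, f i z ∂μ i := by
  refine (lintegral_prod_eq_prod_lintegral_of_indepFun (μ := Measure.pi μ) Finset.univ
    (fun i z => f i (z i)) (iIndepFun_pi fun i => (hf i).aemeasurable)
    (fun i => (hf i).comp (measurable_pi_apply i))).trans ?_
  refine Finset.prod_congr rfl fun i _ => ?_
  exact (measurePreserving_eval μ i).lintegral_comp (hf i)

theorem pi_withDensity_of_isProbabilityMeasure {ι : Type*} [Fintype ι] {X : ι → Type*}
    [∀ i, MeasurableSpace (X i)] (μ : (i : ι) → Measure (X i)) [∀ i, IsProbabilityMeasure (μ i)]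
    {f : (i : ι) → X i → ℝ≥0∞} (hf : ∀ i, Measurable (f i))
    [∀ i, SigmaFinite ((μ i).withDensity (f i))] :
    Measure.pi (fun i => (μ i).withDensity (f i)) =
      (Measure.pi μ).withDensity fun z => ∏ i, f i (z i) := by
  refine Measure.pi_eq fun s hs => ?_
  rw [withDensity_apply _ (MeasurableSet.univ_pi hs),
    ← lintegral_indicator (MeasurableSet.univ_pi hs)]
  have h : ∀ z, (Set.univ.pi s).indicator (fun z => ∏ i, f i (z i)) z =
      ∏ i, (s i).indicator (f i) (z i) := by
    intro z
    by_cases hz : z ∈ Set.univ.pi s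
    · rw [Set.indicator_of_mem hz]
      exact Finset.prod_congr rfl fun i _ => (Set.indicator_of_mem (hz i trivial) _).symm
    · rw [Set.indicator_of_notMem hz]
      simp only [Set.mem_univ_pi, not_forall] at hz
      obtain ⟨i, hi⟩ := hz
      exact (Finset.prod_eq_zero (Finset.mem_univ i) (Set.indicator_of_notMem hi _)).symm
  simp_rw [h]
  rw [lintegral_pi_prod μ fun i => (hf i).indicator (hs i)]
  refine Finset.prod_congr rfl fun i _ => ?_
  rw [withDensity_apply _ (hs i), lintegral_indicator (hs i)]

/-- The law `CN(0, v)` has a density with respect to `CN(0, 2v)`. -/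
theorem complexNormal_eq_withDensity_two_mul {v : ℝ≥0} (hv : 0 < v) :
    complexNormal v = (complexNormal (2 * v)).withDensity
      fun z => ENNReal.ofReal (2 * Real.exp (-(‖z‖ ^ 2 / (2 * v)))) := by
  have hvr : (0 : ℝ) < v := by exact_mod_cast hv
  rw [complexNormal_eq_withDensity hv, complexNormal_eq_withDensity (by positivity),
    ← withDensity_mul _ (continuous_complexNormalPDF _ _).measurable.ennreal_ofReal (by fun_prop)]
  congr 1
  ext z
  rw [Pi.mul_apply, ← ENNReal.ofReal_mul (complexNormalPDF_nonneg (by positivity) _ _)]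
  congr 1
  simp only [complexNormalPDF, sub_zero]
  push_cast
  rw [mul_mul_mul_comm, ← Real.exp_add]
  congr 1
  · field_simp
  · congr 1
    field_simp
    ring

theorem one_add_sum_le_prod_one_add_real {ι : Type*} (s : Finset ι) (f : ι → ℝ)
    (hf : ∀ i, 0 ≤ f i) : 1 + ∑ i ∈ s, f i ≤ ∏ i ∈ s, (1 + f i) := by
  induction s using Finset.cons_induction with
  | empty => simp
  | cons j s hj ih =>
    rw [Finset.sum_cons, Finset.prod_cons]
    have h1 : 0 ≤ ∑ i ∈ s, f i := Finset.sum_nonneg fun i _ => hf i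
    have h2 := mul_le_mul_of_nonneg_left ih (by linarith [hf j] : 0 ≤ 1 + f j)
    nlinarith [mul_nonneg (hf j) h1]

/-- A polynomial weight under independent complex Gaussians costs a constant factor and a doubling
of the variances. -/
theorem lintegral_weight_mul_comp_linearCombination_le {ι : Type*} [Fintype ι] (v : ι → ℝ≥0)
    (hv : ∀ i, 0 < v i) (a : ι → ℂ) (p : ι → ℝ) (hp : ∀ i, 0 ≤ p i) :
    ∃ C : ℝ, 0 < C ∧ ∀ φ : ℂ → ℝ≥0∞, Measurable φ →
      ∫⁻ z, ENNReal.ofReal (1 + ∑ i, ‖z i‖ ^ 2 * p i) * φ (∑ i, a i * z i)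
          ∂Measure.pi (fun i => complexNormal (v i)) ≤
        ENNReal.ofReal C * ∫⁻ w, φ w ∂complexNormal (∑ i, ‖a i‖₊ ^ 2 * (2 * v i)) := by
  have hvr : ∀ i, (0 : ℝ) < v i := fun i => by exact_mod_cast hv i
  refine ⟨∏ i, (2 * (1 + 2 * v i * p i)), Finset.prod_pos fun i _ => ?_, fun φ hφ => ?_⟩
  · have := hvr i
    have := hp i
    positivity
  set d : (i : ι) → ℂ → ℝ≥0∞ :=
    fun i z => ENNReal.ofReal (2 * Real.exp (-(‖z‖ ^ 2 / (2 * v i)))) with hd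
  have hdm : ∀ i, Measurable (d i) := fun i => by simp only [hd]; fun_prop
  have hprob : ∀ i, SigmaFinite ((complexNormal (2 * v i)).withDensity (d i)) := fun i => by
    rw [hd, ← complexNormal_eq_withDensity_two_mul (hv i)]
    infer_instance
  have hpi : Measure.pi (fun i => complexNormal (v i)) =
      (Measure.pi fun i => complexNormal (2 * v i)).withDensity fun z => ∏ i, d i (z i) := by
    rw [← pi_withDensity_of_isProbabilityMeasure _ hdm]
    congr 1
    ext1 i
    exact complexNormal_eq_withDensity_two_mul (hv i)
  rw [hpi, lintegral_withDensity_eq_lintegral_mul _ (by fun_prop) (by fun_prop),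
    ← map_linearCombination_complexNormal (fun i => 2 * v i) a, lintegral_map hφ (by fun_prop),
    ← lintegral_const_mul _ (by fun_prop)]
  refine lintegral_mono fun z => ?_
  rw [Pi.mul_apply, ← mul_assoc]
  gcongr
  rw [hd, ← ENNReal.ofReal_prod_of_nonneg (fun i _ => by positivity),
    ← ENNReal.ofReal_mul (Finset.prod_nonneg fun i _ => by positivity)]
  refine ENNReal.ofReal_le_ofReal ?_
  -- Once the weight is split over the coordinates, each factor is paid for by the decaying density
  -- of `CN(0, v)` relative to `CN(0, 2v)`.
  have h1 : 1 + ∑ i, ‖z i‖ ^ 2 * p i ≤ ∏ i, (1 + ‖z i‖ ^ 2 * p i) :=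
    one_add_sum_le_prod_one_add_real _ _ fun i => mul_nonneg (by positivity) (hp i)
  calc _ ≤ (∏ i, 2 * Real.exp (-(‖z i‖ ^ 2 / (2 * v i)))) * ∏ i, (1 + ‖z i‖ ^ 2 * p i) := by
        gcongr
    _ = ∏ i, (2 * Real.exp (-(‖z i‖ ^ 2 / (2 * v i))) * (1 + ‖z i‖ ^ 2 * p i)) :=
        Finset.prod_mul_distrib.symm
    _ ≤ _ := by
        refine Finset.prod_le_prod (fun i _ => ?_) fun i _ => ?_
        · have := hp i
          positivity
        · have hv' := hvr i
          have hp' := hp i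
          rw [mul_assoc]
          gcongr
          rw [Real.exp_neg, inv_mul_le_iff₀ (Real.exp_pos _)]
          set x := ‖z i‖ ^ 2 with hx
          have hx0 : 0 ≤ x := by positivity
          have h2 := Real.add_one_le_exp (x / (2 * v i))
          have h3 : 1 + x * p i ≤ (x / (2 * v i) + 1) * (1 + 2 * v i * p i) := by
            have h4 : (x / (2 * v i) + 1) * (1 + 2 * v i * p i) =
                1 + x * p i + (x / (2 * v i) + 2 * v i * p i) := by
              field_simp
              ring
            rw [h4]
            have : 0 ≤ x / (2 * v i) + 2 * v i * p i := by positivity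
            linarith
          exact h3.trans (by gcongr)

theorem pi_pi_map_swap {ι κ : Type*} [Fintype ι] [Fintype κ] {X : Type*} [MeasurableSpace X]
    (μ : ι → κ → Measure X) [∀ i j, IsProbabilityMeasure (μ i j)] :
    (Measure.pi fun i => Measure.pi fun j => μ i j).map (fun f j i => f i j) =
      Measure.pi fun j => Measure.pi fun i => μ i j := by
  symm
  refine Measure.pi_eq_generateFrom (fun _ => generateFrom_pi) (fun _ => isPiSystem_pi)
    (fun j => Measure.FiniteSpanningSetsIn.pi fun i => (μ i j).toFiniteSpanningSetsIn) ?_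
  intro s hs
  choose t ht hst using hs
  have hm : Measurable (fun (f : ι → κ → X) j i => f i j) := by fun_prop
  have hs' : ∀ j, MeasurableSet (s j) := fun j => by
    rw [← hst j]
    exact MeasurableSet.univ_pi fun i => ht j i trivial
  rw [Measure.map_apply hm (MeasurableSet.univ_pi hs')]
  have hpre : (fun (f : ι → κ → X) j i => f i j) ⁻¹' Set.univ.pi s =
      Set.univ.pi fun i => Set.univ.pi fun j => t j i := by
    ext f
    simp only [Set.mem_preimage, Set.mem_univ_pi, ← hst]
    exact forall_comm
  rw [hpre]
  simp_rw [← hst, Measure.pi_pi]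
  exact Finset.prod_comm

/-! ### Independence of the relays -/

namespace RelayNetwork

variable {K L R : ℕ} (N : RelayNetwork K L R)

/-- The law of the channels from and to relay `r`. -/
def relayLaw (r : Fin R) : Measure ((Fin K → ℂ) × (Fin L → ℂ)) :=
  (Measure.pi fun k => complexNormal (N.varF k r)).prod
    (Measure.pi fun l => complexNormal (N.varG r l))

instance (r : Fin R) : IsProbabilityMeasure (N.relayLaw r) := by
  unfold relayLaw; infer_instance

instance : IsProbabilityMeasure N.channelLaw := by
  unfold channelLaw; infer_instance

instance (L R : ℕ) : IsProbabilityMeasure (noiseLaw L R) := by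
  unfold noiseLaw; infer_instance

/-- The channels from and to relay `r`. -/
def relayChannels (h : ChannelState K L R) (r : Fin R) : (Fin K → ℂ) × (Fin L → ℂ) :=
  (fun k => h.1 k r, h.2 r)

/-- The channels of different relays are independent. -/
theorem measurePreserving_relayChannels :
    MeasurePreserving relayChannels N.channelLaw (Measure.pi N.relayLaw) := by
  have h1 : MeasurePreserving (fun (f : Fin K → Fin R → ℂ) r k => f k r)
      (Measure.pi fun k => Measure.pi fun r => complexNormal (N.varF k r))
      (Measure.pi fun r => Measure.pi fun k => complexNormal (N.varF k r)) :=
    ⟨by fun_prop, pi_pi_map_swap _⟩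
  have h2 := h1.prod (MeasurePreserving.id
    (Measure.pi fun r => Measure.pi fun l => complexNormal (N.varG r l)))
  exact (measurePreserving_arrowProdEquivProdArrow (Fin K → ℂ) (Fin L → ℂ) (Fin R)
    (fun r => Measure.pi fun k => complexNormal (N.varF k r))
    (fun r => Measure.pi fun l => complexNormal (N.varG r l))).symm.comp h2

theorem lintegral_prod_relayChannels {φ : Fin R → (Fin K → ℂ) × (Fin L → ℂ) → ℝ≥0∞}
    (hφ : ∀ r, Measurable (φ r)) :
    ∫⁻ h, ∏ r, φ r (relayChannels h r) ∂N.channelLaw = ∏ r, ∫⁻ z, φ r z ∂N.relayLaw r := by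
  rw [← lintegral_pi_prod N.relayLaw hφ,
    ← N.measurePreserving_relayChannels.lintegral_comp (by fun_prop)]

end RelayNetwork

/-! ### Decoding errors and the exponential bound on the conditional error rate -/

theorem exists_argmax_eq {ι : Type} [Nonempty ι] :
    ∃ G : (ι → Prop) → ι, ∀ f : ι → ℝ, argmax f = G fun i => ∀ j, f j ≤ f i :=
  ⟨fun p => Classical.epsilon p, fun _ => rfl⟩

/-- The tie-breaking rule factors through the set of maximizers, which depends measurably on the
parameter and takes only finitely many values. -/
theorem measurableSet_setOf_argmax {ι : Type} [Nonempty ι] [Finite ι] {α : Type*}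
    [MeasurableSpace α] {f : ι → α → ℝ} (hf : ∀ i, Measurable (f i)) (p : ι → Prop) :
    MeasurableSet {y | p (argmax fun i => f i y)} := by
  obtain ⟨G, hG⟩ := exists_argmax_eq (ι := ι)
  simp_rw [hG]
  have h : Measurable fun (y : α) (i : ι) => ∀ j, f j y ≤ f i y :=
    measurable_pi_lambda _ fun i => Measurable.forall fun j =>
      measurableSet_setOfPred.1 (measurableSet_le (hf j) (hf i))
  exact h (Set.to_countable {q | p (G q)}).measurableSet

namespace RelayNetwork

variable {K L R : ℕ} (N : RelayNetwork K L R)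

theorem rho_nonneg {P : ℝ} (hP : 0 ≤ P) (h : ChannelState K L R) (r : Fin R) :
    0 ≤ N.rho P h r := by
  unfold rho
  have := (N.pR_pos r).le
  exact div_nonneg (by positivity) (add_nonneg zero_le_one (Finset.sum_nonneg fun i _ =>
    mul_nonneg (by positivity) (mul_nonneg (N.pS_pos i).le hP)))

theorem one_le_noiseVar {P : ℝ} (hP : 0 ≤ P) (x : Fin R → ℂ) (h : ChannelState K L R)
    (l : Fin L) : 1 ≤ N.noiseVar P x h l := by
  unfold noiseVar
  have : 0 ≤ ∑ r, N.rho P h r * ‖h.2 r l‖ ^ 2 * ‖x r‖ ^ 2 := Finset.sum_nonneg fun r _ =>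
    mul_nonneg (mul_nonneg (N.rho_nonneg hP h r) (by positivity)) (by positivity)
  linarith

instance : Nonempty N.Symbols := ⟨fun k => ⟨_, (N.S_nonempty k).choose_spec⟩⟩

theorem received_eq (P : ℝ) (x : Fin R → ℂ) (h : ChannelState K L R) (s : N.Symbols)
    (η : NoiseState L R) (l : Fin L) :
    N.received P x h s η l = N.signalMean P x h s l +
      ((∑ r, h.2 r l * x r * (Real.sqrt (N.rho P h r) : ℂ) * η.1 r) + η.2 l) := by
  unfold received signalMean relayTransmitted relayReceived
  rw [← add_assoc]
  congr 1
  rw [Finset.sum_comm, ← Finset.sum_add_distrib]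
  refine Finset.sum_congr rfl fun r _ => ?_
  rw [mul_add, mul_add, Finset.mul_sum, Finset.mul_sum]
  congr 1
  · refine Finset.sum_congr rfl fun k _ => ?_
    ring
  · ring

theorem noiseLaw_map_received {P : ℝ} (hP : 0 ≤ P) (x : Fin R → ℂ) (h : ChannelState K L R)
    (s : N.Symbols) (l : Fin L) :
    (noiseLaw L R).map (fun η => N.received P x h s η l) =
      (volume : Measure ℂ).withDensity fun y =>
        ENNReal.ofReal (complexNormalPDF (N.signalMean P x h s l) (N.noiseVar P x h l) y) := by
  have hvar := N.one_le_noiseVar hP x h l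
  obtain ⟨v, hv⟩ : ∃ v : ℝ≥0, (v : ℝ) = N.noiseVar P x h l :=
    ⟨⟨_, zero_le_one.trans hvar⟩, rfl⟩
  have hsumv : ∑ r, ‖h.2 r l * x r * (Real.sqrt (N.rho P h r) : ℂ)‖₊ ^ 2 * 1 + 1 = v := by
    ext
    rw [hv]
    push_cast
    unfold noiseVar
    rw [add_comm]
    congr 1
    refine Finset.sum_congr rfl fun r _ => ?_
    rw [mul_one, norm_mul, norm_mul, mul_pow, mul_pow, Complex.norm_real, Real.norm_eq_abs, sq_abs,
      Real.sq_sqrt (N.rho_nonneg hP h r)]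
    ring
  have hsum : (noiseLaw L R).map
      (fun η => (∑ r, h.2 r l * x r * (Real.sqrt (N.rho P h r) : ℂ) * η.1 r) + η.2 l) =
      complexNormal v := by
    have e1 := map_linearCombination_complexNormal (fun _ : Fin R => 1)
      (fun r => h.2 r l * x r * (Real.sqrt (N.rho P h r) : ℂ))
    have e2 := (measurePreserving_eval (fun _ : Fin L => complexNormal 1) l).map_eq
    rw [← hsumv, ← conv_complexNormal, ← e1]
    conv_rhs => arg 2; rw [← e2]
    rw [Measure.conv, Measure.map_prod_map _ _ (by fun_prop) (by fun_prop),
      Measure.map_map (by fun_prop) (by fun_prop)]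
    rfl
  have hpos : 0 < v := by
    rw [← NNReal.coe_pos, hv]
    exact zero_lt_one.trans_le hvar
  rw [← hv, ← map_const_add_complexNormal hpos (N.signalMean P x h s l), ← hsum,
    Measure.map_map (by fun_prop) (by fun_prop)]
  congr 1
  ext η
  exact N.received_eq P x h s η l

theorem measurable_received (P : ℝ) (x : Fin R → ℂ) (h : ChannelState K L R)
    (s : N.Symbols) (l : Fin L) : Measurable fun η => N.received P x h s η l := by
  unfold received relayTransmitted relayReceived
  fun_prop

theorem measurable_posterior (P : ℝ) (x : Fin R → ℂ) (h : ChannelState K L R) (l : Fin L)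
    (t : N.SuperSymbol l) : Measurable fun y => N.posterior P x h l y t := by
  unfold posterior
  have hm : ∀ m v, Measurable (complexNormalPDF m v) :=
    fun m v => (continuous_complexNormalPDF m v).measurable
  fun_prop

theorem measurableSet_decode_ne (P : ℝ) (x : Fin R → ℂ) (h : ChannelState K L R) (l : Fin L)
    (t : N.SuperSymbol l) : MeasurableSet {y | N.decode P x h l y ≠ t} :=
  measurableSet_setOf_argmax (fun i => N.measurable_posterior P x h l i) (· ≠ t)

theorem CNER_le_one (P : ℝ) (x : Fin R → ℂ) (h : ChannelState K L R) : N.CNER P x h ≤ 1 := by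
  unfold CNER
  refine ENNReal.div_le_of_le_mul ?_
  rw [one_mul]
  refine (Finset.sum_le_sum fun s _ => prob_le_one).trans ?_
  simp

/-- Ensures that `toReal` in `NER` never meets `⊤`, so lower bounds on the integral survive it. -/
theorem lintegral_CNER_le_one (P : ℝ) (Q : ChannelState K L R → (Fin R → ℂ)) :
    ∫⁻ h, N.CNER P (Q h) h ∂N.channelLaw ≤ 1 :=
  (lintegral_mono fun h => N.CNER_le_one P (Q h) h).trans (by simp)

/-- If the decoder of receiver `l` errs, then some other vector of symbols has a likelihood not much
below that of the transmitted one. -/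
theorem exists_pdf_le_of_decode_ne {P : ℝ} (hP : 0 ≤ P) (x : Fin R → ℂ) (h : ChannelState K L R)
    (l : Fin L) (y : ℂ) (s : N.Symbols) (hne : N.decode P x h l y ≠ N.desired l s) :
    ∃ s', s ≠ s' ∧ complexNormalPDF (N.signalMean P x h s l) (N.noiseVar P x h l) y ≤
      Fintype.card N.Symbols *
        complexNormalPDF (N.signalMean P x h s' l) (N.noiseVar P x h l) y := by
  classical
  have hv : 0 < N.noiseVar P x h l := zero_lt_one.trans_le (N.one_le_noiseVar hP x h l)
  set p : N.Symbols → ℝ :=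
    fun s => complexNormalPDF (N.signalMean P x h s l) (N.noiseVar P x h l) y with hp
  have hp0 : ∀ s, 0 < p s := fun s => complexNormalPDF_pos hv _ _
  by_contra! hcon
  have hcard : (0 : ℝ) < Fintype.card N.Symbols := by exact_mod_cast Fintype.card_pos
  have hspec := argmax_spec (N.posterior P x h l y) (N.desired l s)
  change N.posterior P x h l y (N.desired l s) ≤ N.posterior P x h l y (N.decode P x h l y) at hspec
  have hden : 0 < ∑ s : N.Symbols, (Fintype.card N.Symbols : ℝ)⁻¹ * p s :=
    Finset.sum_pos (fun s _ => mul_pos (inv_pos.2 hcard) (hp0 s)) Finset.univ_nonempty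
  unfold posterior at hspec
  rw [div_le_div_iff_of_pos_right hden, ← Finset.mul_sum, ← Finset.mul_sum,
    mul_le_mul_iff_right₀ (inv_pos.2 hcard)] at hspec
  have h1 : p s ≤ ∑ s' with N.desired l s' = N.desired l s, p s' :=
    Finset.single_le_sum (f := p) (fun i _ => (hp0 i).le) (by simp)
  -- The decoder compares sums of likelihoods over classes. The winning class does not contain `s`,
  -- so if each of its members had likelihood below `p s / card`, its sum would stay below `p s`,
  -- hence below the sum over the class of `s`.
  have h2 : ∑ s' with N.desired l s' = N.decode P x h l y, Fintype.card N.Symbols * p s' <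
      Fintype.card N.Symbols * p s := by
    rcases (Finset.univ.filter fun s' => N.desired l s' = N.decode P x h l y).eq_empty_or_nonempty
      with he | hn
    · rw [he, Finset.sum_empty]
      exact mul_pos hcard (hp0 s)
    · refine (Finset.sum_lt_sum_of_nonempty hn (g := fun _ => p s) fun s' hs' => ?_).trans_le ?_
      · refine hcon s' fun hss => hne ?_
        rw [hss]
        exact (Finset.mem_filter.1 hs').2.symm
      · rw [Finset.sum_const, nsmul_eq_mul]
        gcongr
        · exact (hp0 s).le
        · exact Finset.card_le_univ _
  rw [← Finset.mul_sum, mul_lt_mul_iff_right₀ hcard] at h2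
  exact lt_irrefl _ (h1.trans_lt (hspec.trans_lt h2))

end RelayNetwork

/-- The Bhattacharyya bound for two complex Gaussians of equal variance. -/
theorem withDensity_setOf_pdf_le_le {m m' : ℂ} {v a : ℝ} (hv : 0 < v) (ha : 0 < a) :
    (volume : Measure ℂ).withDensity (fun y => ENNReal.ofReal (complexNormalPDF m v y))
        {y | complexNormalPDF m v y ≤ a * complexNormalPDF m' v y} ≤
      ENNReal.ofReal (√a * Real.exp (-(‖m - m'‖ ^ 2 / (4 * v)))) := by
  have hc := continuous_complexNormalPDF m v
  have hc' := continuous_complexNormalPDF m' v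
  have hms : MeasurableSet {y | complexNormalPDF m v y ≤ a * complexNormalPDF m' v y} :=
    measurableSet_le hc.measurable (hc'.measurable.const_mul a)
  rw [withDensity_apply _ hms]
  have hpt : ∀ y ∈ {y | complexNormalPDF m v y ≤ a * complexNormalPDF m' v y},
      ENNReal.ofReal (complexNormalPDF m v y) ≤
        ENNReal.ofReal (√a * Real.exp (-(‖m - m'‖ ^ 2 / (4 * v)))) *
          ENNReal.ofReal (complexNormalPDF ((m + m') / 2) v y) := by
    intro y hy
    rw [← ENNReal.ofReal_mul (by positivity)]
    refine ENNReal.ofReal_le_ofReal ?_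
    -- By the parallelogram law, the geometric mean of the two densities is a multiple of the
    -- density centred at the midpoint. On the set in question the first density is at most `√a`
    -- times this mean.
    have hid : (Real.exp (-(‖m - m'‖ ^ 2 / (4 * v))) * complexNormalPDF ((m + m') / 2) v y) ^ 2 =
        complexNormalPDF m v y * complexNormalPDF m' v y := by
      simp only [complexNormalPDF]
      rw [mul_pow, mul_pow, ← Real.exp_nat_mul, ← Real.exp_nat_mul, mul_mul_mul_comm, ← sq,
        ← Real.exp_add, mul_left_comm, ← Real.exp_add]
      congr 2
      have hpar := parallelogram_law_with_norm ℝ (y - m) (y - m')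
      have e1 : y - m + (y - m') = (2 : ℂ) * (y - (m + m') / 2) := by ring
      have e2 : y - m - (y - m') = -(m - m') := by ring
      rw [e1, e2, norm_neg, norm_mul, Complex.norm_ofNat] at hpar
      generalize ‖y - (m + m') / 2‖ = c at hpar ⊢
      field_simp
      push_cast
      linarith
    have h0 : 0 ≤ √a * (Real.exp (-(‖m - m'‖ ^ 2 / (4 * v))) *
        complexNormalPDF ((m + m') / 2) v y) :=
      mul_nonneg (by positivity) (mul_nonneg (by positivity) (complexNormalPDF_nonneg hv.le _ _))
    rw [mul_assoc]
    refine abs_le_of_sq_le_sq' ?_ h0 |>.2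
    rw [mul_pow, hid, Real.sq_sqrt ha.le]
    have := mul_le_mul_of_nonneg_left (show complexNormalPDF m v y ≤ a * complexNormalPDF m' v y
      from hy) (complexNormalPDF_nonneg hv.le m y)
    linarith
  refine (setLIntegral_mono' hms hpt).trans ((setLIntegral_le_lintegral _ _).trans ?_)
  rw [lintegral_const_mul _ (continuous_complexNormalPDF _ _).measurable.ennreal_ofReal,
    lintegral_complexNormalPDF hv, mul_one]

namespace RelayNetwork

variable {K L R : ℕ} (N : RelayNetwork K L R)

/-- This form is exactly the exponent of the Bhattacharyya bound. -/
theorem pairSNR_eq (P : ℝ) (x : Fin R → ℂ) (h : ChannelState K L R) (l : Fin L)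
    (s s' : N.Symbols) :
    N.pairSNR P x h l s s' =
      ‖N.signalMean P x h s l - N.signalMean P x h s' l‖ ^ 2 / (4 * N.noiseVar P x h l) := by
  unfold pairSNR noiseVar signalMean
  congr 3
  rw [← Finset.sum_sub_distrib]
  refine Finset.sum_congr rfl fun k _ => ?_
  rw [← Finset.sum_sub_distrib, Finset.mul_sum]
  refine Finset.sum_congr rfl fun r _ => ?_
  ring

/-- The pairs of distinct symbol vectors. -/
abbrev DistinctPairs : Type := {p : N.Symbols × N.Symbols // p.1 ≠ p.2}

theorem networkSNR_le (P : ℝ) (x : Fin R → ℂ) (h : ChannelState K L R) (l : Fin L)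
    (p : N.DistinctPairs) : N.networkSNR P x h ≤ N.pairSNR P x h l p.1.1 p.1.2 :=
  (ciInf_le (Set.finite_range _).bddBelow l).trans (ciInf_le (Set.finite_range _).bddBelow p)

/-- The pair behind the lower bound: the other transmitters cancel in the difference of the means,
and confusing the two vectors is an error at receiver `l`. -/
theorem exists_symbols_pair : ∃ (l : Fin L) (k : Fin K) (s s' : N.Symbols), k ∈ N.D l ∧
    s k ≠ s' k ∧ ∀ i, i ≠ k → s i = s' i := by
  obtain ⟨k, a, ha, b, hb, hab⟩ := N.S_nontrivial
  obtain ⟨l, hl⟩ := N.D_cover k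
  obtain ⟨s⟩ : Nonempty N.Symbols := inferInstance
  refine ⟨l, k, Function.update s k ⟨a, ha⟩, Function.update s k ⟨b, hb⟩, hl, ?_, ?_⟩
  · simpa using hab
  · intro i hi
    simp [hi]

instance : Nonempty N.DistinctPairs := by
  obtain ⟨-, k, s, s', -, hne, -⟩ := N.exists_symbols_pair
  exact ⟨⟨(s, s'), fun h => hne (by rw [show s = s' from h])⟩⟩

theorem nonempty_receivers {K L R : ℕ} (N : RelayNetwork K L R) : Nonempty (Fin L) := ⟨N.exists_symbols_pair.choose⟩

theorem exists_networkSNR_eq (P : ℝ) (x : Fin R → ℂ) (h : ChannelState K L R) :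
    ∃ (l : Fin L) (p : N.DistinctPairs), N.networkSNR P x h = N.pairSNR P x h l p.1.1 p.1.2 := by
  have := N.nonempty_receivers
  obtain ⟨l, hl⟩ := exists_eq_ciInf_of_finite
    (f := fun l : Fin L => ⨅ p : N.DistinctPairs, N.pairSNR P x h l p.1.1 p.1.2)
  obtain ⟨p, hp⟩ := exists_eq_ciInf_of_finite
    (f := fun p : N.DistinctPairs => N.pairSNR P x h l p.1.1 p.1.2)
  exact ⟨l, p, by rw [networkSNR, ← hl, ← hp]⟩

/-- The conditional error rate decays exponentially in the network SNR. -/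
theorem exists_CNER_le : ∃ C : ℝ, 0 < C ∧ ∀ P : ℝ, 0 ≤ P → ∀ (x : Fin R → ℂ)
    (h : ChannelState K L R),
    N.CNER P x h ≤ ENNReal.ofReal (C * Real.exp (-N.networkSNR P x h)) := by
  classical
  have hcard : (0 : ℝ) < Fintype.card N.Symbols := by exact_mod_cast Fintype.card_pos
  have hL : (0 : ℝ) < Fintype.card (Fin L) := by
    have := N.nonempty_receivers
    exact_mod_cast Fintype.card_pos
  refine ⟨Fintype.card (Fin L) * (Fintype.card N.Symbols * √(Fintype.card N.Symbols)),
    by positivity, fun P hP x h => ?_⟩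
  set B : ℝ := √(Fintype.card N.Symbols) * Real.exp (-N.networkSNR P x h) with hB
  have hB0 : 0 ≤ B := by positivity
  have hs : ∀ s : N.Symbols, noiseLaw L R
      {η | ∃ l, N.decode P x h l (N.received P x h s η l) ≠ N.desired l s} ≤
      ENNReal.ofReal (Fintype.card (Fin L) * (Fintype.card N.Symbols * B)) := by
    intro s
    set E : Fin L → N.Symbols → Set ℂ := fun l s' =>
      {y | complexNormalPDF (N.signalMean P x h s l) (N.noiseVar P x h l) y ≤
        Fintype.card N.Symbols *
          complexNormalPDF (N.signalMean P x h s' l) (N.noiseVar P x h l) y} with hE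
    have hsub : {η | ∃ l, N.decode P x h l (N.received P x h s η l) ≠ N.desired l s} ⊆
        ⋃ l, ⋃ s' ∈ {s' | s ≠ s'}, (fun η => N.received P x h s η l) ⁻¹' E l s' := by
      rintro η ⟨l, hl⟩
      obtain ⟨s', hne, hle⟩ := N.exists_pdf_le_of_decode_ne hP x h l _ s hl
      exact Set.mem_iUnion.2 ⟨l, Set.mem_iUnion₂.2 ⟨s', hne, hle⟩⟩
    have hone : ∀ l, ∀ s' : N.Symbols, s ≠ s' →
        noiseLaw L R ((fun η => N.received P x h s η l) ⁻¹' E l s') ≤ ENNReal.ofReal B := by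
      intro l s' hne
      refine (Measure.le_map_apply (N.measurable_received P x h s l).aemeasurable _).trans ?_
      rw [N.noiseLaw_map_received hP x h s l]
      refine (withDensity_setOf_pdf_le_le (zero_lt_one.trans_le (N.one_le_noiseVar hP x h l))
        hcard).trans (ENNReal.ofReal_le_ofReal ?_)
      rw [← N.pairSNR_eq]
      have := N.networkSNR_le P x h l ⟨(s, s'), hne⟩
      rw [hB]
      gcongr
    calc _ ≤ noiseLaw L R
          (⋃ l, ⋃ s' ∈ {s' | s ≠ s'}, (fun η => N.received P x h s η l) ⁻¹' E l s') :=
          measure_mono hsub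
      _ ≤ ∑ l : Fin L, noiseLaw L R
          (⋃ s' ∈ {s' | s ≠ s'}, (fun η => N.received P x h s η l) ⁻¹' E l s') :=
          measure_iUnion_fintype_le _ _
      _ ≤ ∑ _l : Fin L, ∑ _s' : N.Symbols, ENNReal.ofReal B := by
          refine Finset.sum_le_sum fun l _ => ?_
          refine (measure_iUnion_fintype_le _ _).trans (Finset.sum_le_sum fun s' _ => ?_)
          by_cases hne : s ≠ s'
          · simpa [hne] using hone l s' hne
          · simp [hne]
      _ = _ := by
          rw [Finset.sum_const, Finset.sum_const, nsmul_eq_mul, nsmul_eq_mul,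
            ENNReal.ofReal_mul hL.le, ENNReal.ofReal_mul hcard.le,
            ENNReal.ofReal_natCast, ENNReal.ofReal_natCast, Finset.card_univ, Finset.card_univ]
  unfold CNER
  refine ENNReal.div_le_of_le_mul ?_
  refine (Finset.sum_le_sum fun s _ => hs s).trans ?_
  rw [Finset.sum_const, nsmul_eq_mul, mul_comm]
  rw [Finset.card_univ]
  refine mul_le_mul_left (ENNReal.ofReal_le_ofReal (le_of_eq ?_)) _
  rw [hB]
  ring

end RelayNetwork

/-! ### Upper bound for relay selection -/

namespace RelayNetwork

variable {K L R : ℕ} (N : RelayNetwork K L R)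

/-- The coefficients of the difference of two symbol vectors in the signal at a relay. -/
def diffCoeff (s s' : N.Symbols) (k : Fin K) : ℂ :=
  ((s k : ℂ) - (s' k : ℂ)) * (Real.sqrt (N.pS k) : ℂ)

/-- The pairwise signal-to-noise ratio when only relay `r` transmits, as a function of the channels
`z` from and to this relay. -/
def relaySNR (P : ℝ) (r : Fin R) (l : Fin L) (s s' : N.Symbols)
    (z : (Fin K → ℂ) × (Fin L → ℂ)) : ℝ :=
  N.pR r * P ^ 2 * ‖z.2 l‖ ^ 2 * ‖∑ k, N.diffCoeff s s' k * z.1 k‖ ^ 2 /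
    (4 * (1 + P * ∑ k, ‖z.1 k‖ ^ 2 * N.pS k + N.pR r * P * ‖z.2 l‖ ^ 2))

theorem measurable_relaySNR (P : ℝ) (r : Fin R) (l : Fin L) (s s' : N.Symbols) :
    Measurable (N.relaySNR P r l s s') := by
  unfold relaySNR
  fun_prop

/-- With one active relay, clearing the denominator of `rho` leaves an expression in the channels of
that relay alone, as factorization of the expectation requires. -/
theorem pairSNR_relayVector {P : ℝ} (hP : 0 ≤ P) (r : Fin R) (h : ChannelState K L R) (l : Fin L)
    (s s' : N.Symbols) :
    N.pairSNR P (relayVector r) h l s s' = N.relaySNR P r l s s' (relayChannels h r) := by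
  have h1 : ∀ k, ∑ r', h.1 k r' * (Real.sqrt (N.rho P h r') : ℂ) * h.2 r' l * relayVector r r' =
      h.1 k r * (Real.sqrt (N.rho P h r) : ℂ) * h.2 r l := by
    intro k
    rw [Finset.sum_eq_single r]
    · simp [relayVector]
    · intro r' _ hr'
      simp [relayVector, hr']
    · simp
  have h2 : ∑ r', N.rho P h r' * ‖h.2 r' l‖ ^ 2 * ‖relayVector r r'‖ ^ 2 =
      N.rho P h r * ‖h.2 r l‖ ^ 2 := by
    rw [Finset.sum_eq_single r]
    · simp [relayVector]
    · intro r' _ hr'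
      simp [relayVector, hr']
    · simp
  have h3 : ∑ k, ((s k : ℂ) - (s' k : ℂ)) * (Real.sqrt (N.pS k * P) : ℂ) *
      (h.1 k r * (Real.sqrt (N.rho P h r) : ℂ) * h.2 r l) =
      (Real.sqrt P : ℂ) * (Real.sqrt (N.rho P h r) : ℂ) * h.2 r l *
        ∑ k, N.diffCoeff s s' k * h.1 k r := by
    rw [Finset.mul_sum]
    refine Finset.sum_congr rfl fun k _ => ?_
    rw [diffCoeff, Real.sqrt_mul (N.pS_pos k).le]
    push_cast
    ring
  have hρ := N.rho_nonneg hP h r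
  unfold pairSNR
  simp_rw [h1]
  rw [h2, h3, norm_mul, norm_mul, norm_mul, mul_pow, mul_pow, mul_pow, Complex.norm_real,
    Complex.norm_real, Real.norm_eq_abs, Real.norm_eq_abs, sq_abs, sq_abs, Real.sq_sqrt hP,
    Real.sq_sqrt hρ]
  have hF : ∑ i, ‖h.1 i r‖ ^ 2 * (N.pS i * P) = P * ∑ i, ‖h.1 i r‖ ^ 2 * N.pS i := by
    rw [Finset.mul_sum]
    refine Finset.sum_congr rfl fun k _ => ?_
    ring
  have hF0 : 0 ≤ ∑ i, ‖h.1 i r‖ ^ 2 * N.pS i :=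
    Finset.sum_nonneg fun i _ => mul_nonneg (by positivity) (N.pS_pos i).le
  have hq := N.pR_pos r
  unfold rho relaySNR relayChannels
  rw [hF]
  simp only
  have hD : 0 < 1 + P * ∑ i, ‖h.1 i r‖ ^ 2 * N.pS i := by positivity
  field_simp

theorem lintegral_relayLaw_fst (r : Fin R) (k : Fin K) {φ : ℂ → ℝ≥0∞} (hφ : Measurable φ) :
    ∫⁻ z, φ (z.1 k) ∂N.relayLaw r = ∫⁻ w, φ w ∂complexNormal (N.varF k r) :=
  ((measurePreserving_eval (fun k => complexNormal (N.varF k r)) k).comp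
    measurePreserving_fst).lintegral_comp hφ

theorem lintegral_relayLaw_snd (r : Fin R) (l : Fin L) {φ : ℂ → ℝ≥0∞} (hφ : Measurable φ) :
    ∫⁻ z, φ (z.2 l) ∂N.relayLaw r = ∫⁻ w, φ w ∂complexNormal (N.varG r l) :=
  ((measurePreserving_eval (fun l => complexNormal (N.varG r l)) l).comp
    measurePreserving_snd).lintegral_comp hφ

/-- An exponential bound for each relay yields a bound of the network error rate of relay
selection, by independence. -/
theorem exists_NER_GQ_le [NeZero R] (ε : ℝ → ℝ) (hε : ∀ᶠ P in atTop, 0 ≤ ε P)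
    (H : ∀ (r : Fin R) (l : Fin L) (p : N.DistinctPairs), ∃ C : ℝ, 0 < C ∧ ∀ᶠ P : ℝ in atTop,
      ∫⁻ z, ENNReal.ofReal (Real.exp (-(N.relaySNR P r l p.1.1 p.1.2 z / R))) ∂N.relayLaw r ≤
        ENNReal.ofReal (C * ε P)) :
    ∃ C : ℝ, 0 < C ∧ ∀ᶠ P : ℝ in atTop, N.NER P (N.GQ P) ≤ C * ε P ^ R := by
  classical
  have hne := N.nonempty_receivers
  obtain ⟨C₀, hC₀, hCNER⟩ := N.exists_CNER_le
  choose C hC hCP using H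
  have hR : (R : ℝ) ≠ 0 := by exact_mod_cast NeZero.ne R
  have hR0 : (0 : ℝ) < R := by positivity
  refine ⟨C₀ * ∏ r, ∑ l, ∑ p, C r l p, mul_pos hC₀ (Finset.prod_pos fun r _ =>
    Finset.sum_pos (fun l _ => Finset.sum_pos (fun p _ => hC r l p) Finset.univ_nonempty)
      Finset.univ_nonempty), ?_⟩
  have hall : ∀ᶠ P : ℝ in atTop, ∀ r l p,
      ∫⁻ z, ENNReal.ofReal (Real.exp (-(N.relaySNR P r l p.1.1 p.1.2 z / R))) ∂N.relayLaw r ≤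
        ENNReal.ofReal (C r l p * ε P) :=
    eventually_all.2 fun r => eventually_all.2 fun l => eventually_all.2 fun p => hCP r l p
  filter_upwards [hall, hε, eventually_ge_atTop (0 : ℝ)] with P hP hεP hP0
  set φ : Fin R → (Fin K → ℂ) × (Fin L → ℂ) → ℝ≥0∞ := fun r z =>
    ∑ l, ∑ p : N.DistinctPairs,
      ENNReal.ofReal (Real.exp (-(N.relaySNR P r l p.1.1 p.1.2 z / R))) with hφ
  have hm : ∀ r l (p : N.DistinctPairs), Measurable fun z =>
      ENNReal.ofReal (Real.exp (-(N.relaySNR P r l p.1.1 p.1.2 z / R))) := fun r l p => by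
    have := N.measurable_relaySNR P r l p.1.1 p.1.2
    fun_prop
  have hφm : ∀ r, Measurable (φ r) := fun r =>
    Finset.measurable_fun_sum _ fun l _ => Finset.measurable_fun_sum _ fun p _ => hm r l p
  have hpt : ∀ h, N.CNER P (N.GQ P h) h ≤
      ENNReal.ofReal C₀ * ∏ r, φ r (relayChannels h r) := by
    intro h
    refine (hCNER P hP0 _ h).trans ?_
    rw [ENNReal.ofReal_mul hC₀.le]
    gcongr
    set γ := N.networkSNR P (N.GQ P h) h with hγ
    -- One share of the exponent goes to each relay. As `γ` is a maximum, it may be replaced by the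
    -- SNR of relay `r` in the `r`-th share; summing over receivers and pairs covers the minimum
    -- inside that SNR.
    have hexp : Real.exp (-γ) = ∏ _r : Fin R, Real.exp (-(γ / R)) := by
      rw [← Real.exp_sum, Finset.sum_const, Finset.card_univ, Fintype.card_fin, nsmul_eq_mul]
      congr 1
      field_simp
    rw [hexp, ENNReal.ofReal_prod_of_nonneg fun _ _ => (Real.exp_pos _).le]
    refine Finset.prod_le_prod' fun r _ => ?_
    obtain ⟨l, p, hlp⟩ := N.exists_networkSNR_eq P (relayVector r) h
    have hle : N.relaySNR P r l p.1.1 p.1.2 (relayChannels h r) ≤ γ := by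
      rw [← N.pairSNR_relayVector hP0, ← hlp]
      exact argmax_spec (fun r : Fin R => N.networkSNR P (relayVector r) h) r
    calc ENNReal.ofReal (Real.exp (-(γ / R))) ≤ ENNReal.ofReal
          (Real.exp (-(N.relaySNR P r l p.1.1 p.1.2 (relayChannels h r) / R))) := by gcongr
      _ ≤ ∑ p : N.DistinctPairs, ENNReal.ofReal
          (Real.exp (-(N.relaySNR P r l p.1.1 p.1.2 (relayChannels h r) / R))) :=
        Finset.single_le_sum (f := fun p : N.DistinctPairs => ENNReal.ofReal
          (Real.exp (-(N.relaySNR P r l p.1.1 p.1.2 (relayChannels h r) / R))))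
          (fun _ _ => zero_le) (Finset.mem_univ p)
      _ ≤ _ := Finset.single_le_sum (f := fun l => ∑ p : N.DistinctPairs, ENNReal.ofReal
          (Real.exp (-(N.relaySNR P r l p.1.1 p.1.2 (relayChannels h r) / R))))
          (fun _ _ => zero_le) (Finset.mem_univ l)
  have hsum0 : ∀ r, 0 ≤ ∑ l, ∑ p, C r l p := fun r =>
    Finset.sum_nonneg fun l _ => Finset.sum_nonneg fun p _ => (hC r l p).le
  have hint : ∫⁻ h, N.CNER P (N.GQ P h) h ∂N.channelLaw ≤
      ENNReal.ofReal (C₀ * (∏ r, ∑ l, ∑ p, C r l p) * ε P ^ R) := by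
    refine (lintegral_mono hpt).trans ?_
    have hmeas : Measurable fun h : ChannelState K L R => ∏ r, φ r (relayChannels h r) :=
      Finset.measurable_fun_prod _ fun r _ => (hφm r).comp
        ((measurable_pi_apply r).comp N.measurePreserving_relayChannels.measurable)
    rw [lintegral_const_mul _ hmeas, N.lintegral_prod_relayChannels hφm, mul_assoc,
      ENNReal.ofReal_mul hC₀.le]
    gcongr
    have hpow : (∏ r, ∑ l, ∑ p, C r l p) * ε P ^ R = ∏ r, ((∑ l, ∑ p, C r l p) * ε P) := by
      rw [Finset.prod_mul_distrib, Finset.prod_const, Finset.card_univ, Fintype.card_fin]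
    rw [hpow, ENNReal.ofReal_prod_of_nonneg fun r _ => mul_nonneg (hsum0 r) hεP]
    refine Finset.prod_le_prod' fun r _ => ?_
    rw [hφ]
    simp only
    rw [lintegral_finsetSum _ fun l _ => Finset.measurable_fun_sum _ fun p _ => hm r l p,
      Finset.sum_mul, ENNReal.ofReal_sum_of_nonneg fun l _ =>
        mul_nonneg (Finset.sum_nonneg fun p _ => (hC r l p).le) hεP]
    refine Finset.sum_le_sum fun l _ => ?_
    rw [lintegral_finsetSum _ fun p _ => hm r l p, Finset.sum_mul,
      ENNReal.ofReal_sum_of_nonneg fun p _ => mul_nonneg (hC r l p).le hεP]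
    exact Finset.sum_le_sum fun p _ => hP r l p
  unfold NER
  refine ENNReal.toReal_le_of_le_ofReal ?_ hint
  exact mul_nonneg (mul_nonneg hC₀.le (Finset.prod_nonneg fun r _ => hsum0 r)) (pow_nonneg hεP R)

end RelayNetwork

/-- With `m` the minimum and `M` the maximum of `a` and `b`, the fraction is at least `(m - 1) / 3`:
for `m ≥ 1` the denominator is at most `3 M`, and for `m < 1` the bound is negative. -/
theorem exp_neg_harmonic_le {κ a b : ℝ} (hκ : 0 ≤ κ) (ha : 0 ≤ a) (hb : 0 ≤ b) :
    Real.exp (-(κ * (a * b / (1 + a + b)))) ≤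
      Real.exp (κ / 3) * (Real.exp (-(κ / 3 * a)) + Real.exp (-(κ / 3 * b))) := by
  have key : ∀ {m M : ℝ}, 0 ≤ m → m ≤ M → (m - 1) / 3 ≤ m * M / (1 + m + M) := by
    intro m M hm hmM
    rw [div_le_div_iff₀ (by norm_num) (by linarith)]
    nlinarith [mul_nonneg hm (hm.trans hmM), mul_nonneg hm (sub_nonneg.2 hmM)]
  rw [mul_add, ← Real.exp_add, ← Real.exp_add]
  rcases le_total a b with hab | hab
  · refine le_add_of_le_of_nonneg (Real.exp_le_exp.2 ?_) (Real.exp_pos _).le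
    have := mul_le_mul_of_nonneg_left (key ha hab) hκ
    linarith
  · refine le_add_of_nonneg_of_le (Real.exp_pos _).le (Real.exp_le_exp.2 ?_)
    have := mul_le_mul_of_nonneg_left (key hb hab) hκ
    rw [mul_comm b a, add_right_comm] at this
    linarith

namespace RelayNetwork

/-- With a single transmitter, each relay contributes a factor `1 / P`. -/
theorem exists_lintegral_exp_relaySNR_le_of_one {L R : ℕ} [NeZero R] (N : RelayNetwork 1 L R)
    (r : Fin R) (l : Fin L) (p : N.DistinctPairs) :
    ∃ C : ℝ, 0 < C ∧ ∀ᶠ P : ℝ in atTop,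
      ∫⁻ z, ENNReal.ofReal (Real.exp (-(N.relaySNR P r l p.1.1 p.1.2 z / R))) ∂N.relayLaw r ≤
        ENNReal.ofReal (C * (1 / P)) := by
  have hR : (0 : ℝ) < R := by exact_mod_cast Nat.pos_of_ne_zero (NeZero.ne R)
  obtain ⟨⟨s, s'⟩, hne⟩ := p
  have hs : (s 0 : ℂ) - (s' 0 : ℂ) ≠ 0 := by
    intro h
    refine hne (funext fun k => ?_)
    rw [Subsingleton.elim k 0]
    exact Subtype.ext (sub_eq_zero.1 h)
  have hd : 0 < ‖(s 0 : ℂ) - (s' 0 : ℂ)‖ ^ 2 := by positivity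
  set d := ‖(s 0 : ℂ) - (s' 0 : ℂ)‖ ^ 2 with hd_def
  have hp := N.pS_pos 0
  have hq := N.pR_pos r
  have hvF : (0 : ℝ) < N.varF 0 r := by exact_mod_cast N.varF_pos 0 r
  have hvG : (0 : ℝ) < N.varG r l := by exact_mod_cast N.varG_pos r l
  set κ := d / (4 * R) with hκ_def
  have hκ : 0 < κ := by positivity
  refine ⟨Real.exp (κ / 3) * (1 / (κ / 3 * N.pS 0 * N.varF 0 r) +
    1 / (κ / 3 * N.pR r * N.varG r l)), by positivity, ?_⟩
  filter_upwards [eventually_gt_atTop (0 : ℝ)] with P hP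
  have hpt : ∀ z : (Fin 1 → ℂ) × (Fin L → ℂ),
      ENNReal.ofReal (Real.exp (-(N.relaySNR P r l s s' z / R))) ≤
      ENNReal.ofReal (Real.exp (κ / 3)) *
        (ENNReal.ofReal (Real.exp (-(κ / 3 * N.pS 0 * P * ‖z.1 0‖ ^ 2))) +
          ENNReal.ofReal (Real.exp (-(κ / 3 * N.pR r * P * ‖z.2 l‖ ^ 2)))) := by
    intro z
    rw [← ENNReal.ofReal_add (by positivity) (by positivity), ← ENNReal.ofReal_mul (by positivity)]
    refine ENNReal.ofReal_le_ofReal ?_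
    have h := exp_neg_harmonic_le hκ.le (a := N.pS 0 * P * ‖z.1 0‖ ^ 2)
      (b := N.pR r * P * ‖z.2 l‖ ^ 2) (by positivity) (by positivity)
    -- With one transmitter, numerator and denominator contain the same `|f|²`. This harmonic form
    -- is what spares the logarithm.
    have e : N.relaySNR P r l s s' z / R = κ * (N.pS 0 * P * ‖z.1 0‖ ^ 2 *
        (N.pR r * P * ‖z.2 l‖ ^ 2) /
          (1 + N.pS 0 * P * ‖z.1 0‖ ^ 2 + N.pR r * P * ‖z.2 l‖ ^ 2)) := by
      unfold relaySNR diffCoeff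
      simp only [Finset.univ_unique, Finset.sum_singleton, Fin.default_eq_zero, Fin.isValue]
      rw [norm_mul, norm_mul, mul_pow, mul_pow, ← hd_def, Complex.norm_real, Real.norm_eq_abs,
        sq_abs, Real.sq_sqrt hp.le, hκ_def]
      have h1 : 0 < 1 + P * (‖z.1 0‖ ^ 2 * N.pS 0) + N.pR r * P * ‖z.2 l‖ ^ 2 := by positivity
      have h2 : 0 < 1 + N.pS 0 * P * ‖z.1 0‖ ^ 2 + N.pR r * P * ‖z.2 l‖ ^ 2 := by positivity
      field_simp
    rw [e]
    convert h using 4 <;> ring_nf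
  refine (lintegral_mono hpt).trans ?_
  rw [lintegral_const_mul _ (by fun_prop), lintegral_add_left (by fun_prop),
    N.lintegral_relayLaw_fst r 0
      (φ := fun w => ENNReal.ofReal (Real.exp (-(κ / 3 * N.pS 0 * P * ‖w‖ ^ 2)))) (by fun_prop),
    N.lintegral_relayLaw_snd r l
      (φ := fun w => ENNReal.ofReal (Real.exp (-(κ / 3 * N.pR r * P * ‖w‖ ^ 2)))) (by fun_prop),
    lintegral_exp_neg_mul_sq_complexNormal (N.varF_pos 0 r) (by positivity),
    lintegral_exp_neg_mul_sq_complexNormal (N.varG_pos r l) (by positivity),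
    ← ENNReal.ofReal_add (by positivity) (by positivity), ← ENNReal.ofReal_mul (by positivity)]
  refine ENNReal.ofReal_le_ofReal ?_
  rw [mul_assoc _ (_ + _) (1 / P), add_mul, one_div_mul_one_div, one_div_mul_one_div]
  gcongr <;> linarith

/-- Each relay contributes a factor `log P / P`. -/
theorem exists_lintegral_exp_relaySNR_le {K L R : ℕ} [NeZero R] (N : RelayNetwork K L R)
    (r : Fin R) (l : Fin L) (p : N.DistinctPairs) :
    ∃ C : ℝ, 0 < C ∧ ∀ᶠ P : ℝ in atTop,
      ∫⁻ z, ENNReal.ofReal (Real.exp (-(N.relaySNR P r l p.1.1 p.1.2 z / R))) ∂N.relayLaw r ≤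
        ENNReal.ofReal (C * (Real.log P / P)) := by
  have hR : (0 : ℝ) < R := by exact_mod_cast Nat.pos_of_ne_zero (NeZero.ne R)
  obtain ⟨⟨s, s'⟩, hne⟩ := p
  have hq := N.pR_pos r
  have hvG : (0 : ℝ) < N.varG r l := by exact_mod_cast N.varG_pos r l
  obtain ⟨C₀, hC₀, hweight⟩ := lintegral_weight_mul_comp_linearCombination_le
    (fun k => N.varF k r) (fun k => N.varF_pos k r) (N.diffCoeff s s') N.pS
    fun k => (N.pS_pos k).le
  set σ : ℝ≥0 := ∑ k, ‖N.diffCoeff s s' k‖₊ ^ 2 * (2 * N.varF k r) with hσ_def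
  -- Distinct symbol vectors give a nonzero coefficient, so the difference signal is a nondegenerate
  -- Gaussian.
  have hσ : 0 < σ := by
    obtain ⟨k, hk⟩ := Function.ne_iff.1 hne
    refine Finset.sum_pos' (fun _ _ => zero_le) ⟨k, Finset.mem_univ k, ?_⟩
    have h1 : N.diffCoeff s s' k ≠ 0 := by
      refine mul_ne_zero (sub_ne_zero.2 fun h => hk (Subtype.ext h)) ?_
      rw [Complex.ofReal_ne_zero]
      exact (Real.sqrt_pos.2 (N.pS_pos k)).ne'
    have h2 := N.varF_pos k r
    have h3 : 0 < ‖N.diffCoeff s s' k‖₊ := nnnorm_pos.2 h1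
    positivity
  have hσr : (0 : ℝ) < σ := by exact_mod_cast hσ
  set κ := N.pR r / (4 * R) with hκ_def
  have hκ : 0 < κ := by positivity
  -- Small enough for both exponential terms below to be compared, after averaging over `g`, with
  -- the same `1 / (1 + c P U)`.
  set c := min (κ / 2 * N.varG r l) (κ / (2 * N.pR r)) with hc_def
  have hc : 0 < c := lt_min (by positivity) (by positivity)
  have hlogc : 0 < Real.log (1 + c) := Real.log_pos (by linarith)
  refine ⟨2 * C₀ * (((Real.log (1 + c) + 1) / σ + 1) / c), by positivity, ?_⟩
  filter_upwards [eventually_ge_atTop (Real.exp 1)] with P hP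
  have hP1 : 1 ≤ P := (Real.one_le_exp zero_le_one).trans hP
  have hP0 : 0 < P := zero_lt_one.trans_le hP1
  have hlogP : 1 ≤ Real.log P := by rwa [Real.le_log_iff_exp_le hP0]
  set F : (Fin K → ℂ) → ℝ := fun f => ∑ k, ‖f k‖ ^ 2 * N.pS k with hF_def
  set U : (Fin K → ℂ) → ℝ := fun f => ‖∑ k, N.diffCoeff s s' k * f k‖ ^ 2 with hU_def
  have hF0 : ∀ f, 0 ≤ F f := fun f =>
    Finset.sum_nonneg fun k _ => mul_nonneg (by positivity) (N.pS_pos k).le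
  have hU0 : ∀ f, 0 ≤ U f := fun f => by positivity
  have hFm : Measurable F := by simp only [hF_def]; fun_prop
  have hUm : Measurable U := by simp only [hU_def]; fun_prop
  have hpt : ∀ z : (Fin K → ℂ) × (Fin L → ℂ),
      ENNReal.ofReal (Real.exp (-(N.relaySNR P r l s s' z / R))) ≤
        ENNReal.ofReal (Real.exp (-(κ * P * U z.1 / (2 * (1 + F z.1)) * ‖z.2 l‖ ^ 2))) +
          ENNReal.ofReal (Real.exp (-(κ / (2 * N.pR r) * (P * U z.1)))) := by
    intro z
    rw [← ENNReal.ofReal_add (by positivity) (by positivity)]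
    refine ENNReal.ofReal_le_ofReal ?_
    have hf := hF0 z.1
    have hu := hU0 z.1
    have e : N.relaySNR P r l s s' z / R = κ * P ^ 2 * ‖z.2 l‖ ^ 2 * U z.1 /
        (1 + P * F z.1 + N.pR r * P * ‖z.2 l‖ ^ 2) := by
      unfold relaySNR
      change N.pR r * P ^ 2 * ‖z.2 l‖ ^ 2 * U z.1 /
        (4 * (1 + P * F z.1 + N.pR r * P * ‖z.2 l‖ ^ 2)) / R = _
      rw [hκ_def]
      field_simp
    rw [e]
    generalize F z.1 = f at hf ⊢
    generalize U z.1 = u at hu ⊢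
    generalize hG : ‖z.2 l‖ ^ 2 = G
    have hG0 : 0 ≤ G := by rw [← hG]; positivity
    have hD : 0 < 1 + P * f + N.pR r * P * G := by positivity
    -- Either the incoming power dominates the denominator and the exponent is linear in `G`, or the
    -- outgoing channel dominates and `G` cancels. `P ≥ 1` absorbs the summand `1`.
    rcases le_total (N.pR r * G) (1 + f) with h | h
    · refine le_add_of_le_of_nonneg (Real.exp_le_exp.2 (neg_le_neg ?_)) (Real.exp_pos _).le
      have h1 : 1 + P * f + N.pR r * P * G ≤ P * (2 * (1 + f)) := by nlinarith
      calc κ * P * u / (2 * (1 + f)) * G = κ * P ^ 2 * G * u / (P * (2 * (1 + f))) := by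
            field_simp
        _ ≤ _ := by gcongr
    · refine le_add_of_nonneg_of_le (Real.exp_pos _).le (Real.exp_le_exp.2 (neg_le_neg ?_))
      have h1 : 1 + P * f + N.pR r * P * G ≤ P * (2 * N.pR r * G) := by nlinarith
      have hGpos : 0 < G := by
        by_contra! hG'
        nlinarith
      calc κ / (2 * N.pR r) * (P * u) = κ * P ^ 2 * G * u / (P * (2 * N.pR r * G)) := by
            field_simp
        _ ≤ _ := by gcongr
  have hinner : ∀ f : Fin K → ℂ, ∫⁻ g : Fin L → ℂ,
      (ENNReal.ofReal (Real.exp (-(κ * P * U f / (2 * (1 + F f)) * ‖g l‖ ^ 2))) +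
        ENNReal.ofReal (Real.exp (-(κ / (2 * N.pR r) * (P * U f)))))
        ∂(Measure.pi fun l => complexNormal (N.varG r l)) ≤
      2 * (ENNReal.ofReal (1 + F f) * ENNReal.ofReal (1 / (1 + c * P * U f))) := by
    intro f
    have hf := hF0 f
    have hu := hU0 f
    have hc1 : c ≤ κ / 2 * N.varG r l := min_le_left _ _
    have hc2 : c ≤ κ / (2 * N.pR r) := min_le_right _ _
    rw [lintegral_add_left (by fun_prop), (measurePreserving_eval
      (fun l => complexNormal (N.varG r l)) l).lintegral_comp
      (f := fun w => ENNReal.ofReal (Real.exp (-(κ * P * U f / (2 * (1 + F f)) * ‖w‖ ^ 2))))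
      (by fun_prop),
      lintegral_exp_neg_mul_sq_complexNormal (N.varG_pos r l) (by positivity), lintegral_const,
      measure_univ, mul_one, two_mul (ENNReal.ofReal _ * _), ← ENNReal.ofReal_mul (by positivity)]
    generalize F f = f' at hf ⊢
    generalize U f = u at hu ⊢
    have hcu : 0 ≤ c * P * u := by positivity
    refine add_le_add (ENNReal.ofReal_le_ofReal ?_) (ENNReal.ofReal_le_ofReal ?_)
    · have e : 1 / (1 + κ * P * u / (2 * (1 + f')) * N.varG r l) =
          (1 + f') * (1 / (1 + f' + κ / 2 * N.varG r l * P * u)) := by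
        field_simp
      rw [e]
      have : c * P * u ≤ κ / 2 * N.varG r l * P * u := by gcongr
      gcongr
      linarith
    · rw [Real.exp_neg, ← one_div]
      have h1 : 1 + c * P * u ≤ Real.exp (κ / (2 * N.pR r) * (P * u)) := by
        refine le_trans ?_ (Real.add_one_le_exp _)
        have : c * (P * u) ≤ κ / (2 * N.pR r) * (P * u) := by gcongr
        linarith
      have h2 : 1 / Real.exp (κ / (2 * N.pR r) * (P * u)) ≤ 1 / (1 + c * P * u) := by gcongr
      have h3 : 0 ≤ 1 / (1 + c * P * u) := by positivity
      nlinarith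
  calc ∫⁻ z, ENNReal.ofReal (Real.exp (-(N.relaySNR P r l s s' z / R))) ∂N.relayLaw r
      ≤ ∫⁻ z, (ENNReal.ofReal (Real.exp (-(κ * P * U z.1 / (2 * (1 + F z.1)) * ‖z.2 l‖ ^ 2))) +
          ENNReal.ofReal (Real.exp (-(κ / (2 * N.pR r) * (P * U z.1))))) ∂N.relayLaw r :=
        lintegral_mono hpt
    _ ≤ ∫⁻ f, 2 * (ENNReal.ofReal (1 + F f) * ENNReal.ofReal (1 / (1 + c * P * U f)))
          ∂(Measure.pi fun k => complexNormal (N.varF k r)) := by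
        unfold relayLaw
        rw [lintegral_prod _ (by fun_prop)]
        exact lintegral_mono hinner
    _ ≤ 2 * (ENNReal.ofReal C₀ *
          ∫⁻ w, ENNReal.ofReal (1 / (1 + c * P * ‖w‖ ^ 2)) ∂complexNormal σ) := by
        rw [lintegral_const_mul _ (by fun_prop)]
        gcongr
        exact hweight (fun w => ENNReal.ofReal (1 / (1 + c * P * ‖w‖ ^ 2))) (by fun_prop)
    _ ≤ 2 * (ENNReal.ofReal C₀ *
          ENNReal.ofReal ((Real.log (1 + c * P) / σ + 1) / (c * P))) := by
        gcongr
        exact lintegral_inv_one_add_mul_sq_complexNormal_le hσ (by positivity)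
    _ ≤ _ := by
        rw [← ENNReal.ofReal_mul hC₀.le, ← ENNReal.ofReal_ofNat 2,
          ← ENNReal.ofReal_mul (by norm_num)]
        refine ENNReal.ofReal_le_ofReal ?_
        have h1 : Real.log (1 + c * P) ≤ Real.log (1 + c) + Real.log P := by
          rw [← Real.log_mul (by positivity) (by positivity)]
          refine Real.log_le_log (by positivity) ?_
          linarith
        have h2 : Real.log (1 + c * P) / σ + 1 ≤
            ((Real.log (1 + c) + 1) / σ + 1) * Real.log P := by
          have h3 : Real.log (1 + c * P) ≤ (Real.log (1 + c) + 1) * Real.log P := by nlinarith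
          have h4 : Real.log (1 + c * P) / σ ≤ (Real.log (1 + c) + 1) * Real.log P / σ := by
            gcongr
          rw [add_mul, div_mul_eq_mul_div]
          linarith
        calc 2 * (C₀ * ((Real.log (1 + c * P) / σ + 1) / (c * P))) ≤
              2 * (C₀ * (((Real.log (1 + c) + 1) / σ + 1) * Real.log P / (c * P))) := by gcongr
          _ = _ := by field_simp

end RelayNetwork

/-! ### Lower bound for every scheme -/

/-- Two complex Gaussians whose means are close cannot be told apart reliably. -/
theorem exp_neg_four_le_withDensity_add {m m' : ℂ} {v : ℝ} (hv : 0 < v)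
    (hm : ‖m - m'‖ ^ 2 ≤ v) {A A' : Set ℂ} (hA : MeasurableSet A) (hA' : MeasurableSet A')
    (hAA' : A ∪ A' = Set.univ) :
    ENNReal.ofReal (Real.exp (-4)) ≤
      (volume : Measure ℂ).withDensity (fun y => ENNReal.ofReal (complexNormalPDF m v y)) A +
        (volume : Measure ℂ).withDensity (fun y => ENNReal.ofReal (complexNormalPDF m' v y)) A' := by
  set B := Metric.closedBall m (√v) with hB
  have hBm : MeasurableSet B := Metric.isClosed_closedBall.measurableSet
  -- Points of the disc of radius `√v` about `m` lie within `2 √v` of either mean, so both densities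
  -- there are at least `exp (-4) / (π v)`. The disc has area `π v`, and `A`, `A'` cover it.
  have key : ∀ (n : ℂ) (E : Set ℂ), MeasurableSet E → ‖m - n‖ ^ 2 ≤ v →
      ENNReal.ofReal ((Real.pi * v)⁻¹ * Real.exp (-4)) * volume (E ∩ B) ≤
        (volume : Measure ℂ).withDensity (fun y => ENNReal.ofReal (complexNormalPDF n v y)) E := by
    intro n E hE hn
    refine le_trans ?_ (measure_mono (Set.inter_subset_left (t := B)))
    rw [withDensity_apply _ (hE.inter hBm), ← setLIntegral_const]
    refine setLIntegral_mono' (hE.inter hBm) fun y hy => ENNReal.ofReal_le_ofReal ?_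
    refine le_complexNormalPDF hv ?_
    have hy1 : ‖y - m‖ ≤ √v := by simpa [hB, dist_eq_norm] using hy.2
    have hn1 : ‖m - n‖ ≤ √v := Real.le_sqrt_of_sq_le hn
    have h1 : ‖y - n‖ ≤ √v + √v := by
      have := norm_add_le (y - m) (m - n)
      rw [sub_add_sub_cancel] at this
      linarith
    calc ‖y - n‖ ^ 2 ≤ (√v + √v) ^ 2 := by gcongr
      _ = 4 * √v ^ 2 := by ring
      _ = 4 * v := by rw [Real.sq_sqrt hv.le]
  refine le_trans ?_ (add_le_add (key m A hA (by simpa using hv.le)) (key m' A' hA' hm))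
  rw [← mul_add]
  have hvol : volume B ≤ volume (A ∩ B) + volume (A' ∩ B) := by
    refine le_trans (le_of_eq ?_) (measure_union_le _ _)
    rw [← Set.union_inter_distrib_right, hAA', Set.univ_inter]
  refine le_trans (le_of_eq ?_) (mul_le_mul_right hvol _)
  rw [hB, Complex.volume_closedBall, ← ENNReal.ofReal_pow (Real.sqrt_nonneg _), Real.sq_sqrt hv.le,
    ← ENNReal.ofReal_coe_nnreal, ← ENNReal.ofReal_mul hv.le, ← ENNReal.ofReal_mul (by positivity)]
  congr 1
  have := Real.pi_pos
  simp only [NNReal.coe_real_pi]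
  field_simp

namespace RelayNetwork

variable {K L R : ℕ} (N : RelayNetwork K L R)

theorem le_CNER {P : ℝ} (hP : 0 ≤ P) (x : Fin R → ℂ) (h : ChannelState K L R) (l : Fin L)
    (s s' : N.Symbols) (hne : N.desired l s ≠ N.desired l s')
    (hclose : ‖N.signalMean P x h s l - N.signalMean P x h s' l‖ ^ 2 ≤ N.noiseVar P x h l) :
    ENNReal.ofReal (Real.exp (-4) / Fintype.card N.Symbols) ≤ N.CNER P x h := by
  classical
  have hcard : (0 : ℝ) < Fintype.card N.Symbols := by exact_mod_cast Fintype.card_pos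
  have hv : 0 < N.noiseVar P x h l := zero_lt_one.trans_le (N.one_le_noiseVar hP x h l)
  have hle : ∀ s : N.Symbols,
      (volume : Measure ℂ).withDensity (fun y =>
        ENNReal.ofReal (complexNormalPDF (N.signalMean P x h s l) (N.noiseVar P x h l) y))
        {y | N.decode P x h l y ≠ N.desired l s} ≤
      noiseLaw L R {η | ∃ l, N.decode P x h l (N.received P x h s η l) ≠ N.desired l s} := by
    intro s
    rw [← N.noiseLaw_map_received hP x h s l,
      Measure.map_apply (N.measurable_received P x h s l) (N.measurableSet_decode_ne P x h l _)]
    exact measure_mono fun η hη => ⟨l, hη⟩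
  have hss : s ≠ s' := fun hs => hne (by rw [hs])
  have htwo := exp_neg_four_le_withDensity_add hv hclose
    (N.measurableSet_decode_ne P x h l (N.desired l s))
    (N.measurableSet_decode_ne P x h l (N.desired l s')) (by
      refine Set.eq_univ_of_forall fun y => ?_
      by_cases hy : N.decode P x h l y = N.desired l s
      · exact Or.inr fun hy' => hne (hy.symm.trans hy')
      · exact Or.inl hy)
  unfold CNER
  rw [ENNReal.ofReal_div_of_pos hcard, ENNReal.ofReal_natCast]
  refine ENNReal.div_le_div_right (htwo.trans ((add_le_add (hle s) (hle s')).trans ?_)) _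
  rw [← Finset.sum_pair (f := fun s => noiseLaw L R
    {η | ∃ l, N.decode P x h l (N.received P x h s η l) ≠ N.desired l s}) hss]
  exact Finset.sum_le_univ_sum_of_nonneg fun _ => zero_le

/-- Channel states of relay `r` for which this relay cannot help receiver `l` to tell apart two
values of the symbol of transmitter `k`. -/
def weakRelay (P M : ℝ) (k : Fin K) (l : Fin L) (r : Fin R) :
    Set ((Fin K → ℂ) × (Fin L → ℂ)) :=
  {z | M * P * ‖z.1 k‖ ^ 2 ≤ 1 ∨
    M * R * P * ‖z.1 k‖ ^ 2 * ((N.pR r * P) / (1 + ∑ i, ‖z.1 i‖ ^ 2 * (N.pS i * P))) *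
      ‖z.2 l‖ ^ 2 ≤ 1}

theorem measurableSet_weakRelay (P M : ℝ) (k : Fin K) (l : Fin L) (r : Fin R) :
    MeasurableSet (N.weakRelay P M k l r) := by
  unfold weakRelay
  rw [Set.ofPred_or]
  exact (measurableSet_le (by fun_prop) measurable_const).union
    (measurableSet_le (by fun_prop) measurable_const)

/-- Cauchy–Schwarz over the relays accounts for the `R` in `M`. A relay weak by the first
alternative contributes at most its own forwarded noise `y r`; one weak by the second contributes at
most `1 / R`, and these shares add up to at most the unit noise of the receiver. -/
theorem norm_signalMean_sub_sq_le {P : ℝ} (hP : 0 ≤ P) {x : Fin R → ℂ} (hx : ‖x‖ ≤ 1)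
    (h : ChannelState K L R) (k : Fin K) (l : Fin L) (s s' : N.Symbols)
    (hss : ∀ i, i ≠ k → s i = s' i) {M : ℝ}
    (hM : M = R * ‖(s k : ℂ) - (s' k : ℂ)‖ ^ 2 * N.pS k)
    (hweak : ∀ r, relayChannels h r ∈ N.weakRelay P M k l r) :
    ‖N.signalMean P x h s l - N.signalMean P x h s' l‖ ^ 2 ≤ N.noiseVar P x h l := by
  have hS := (N.pS_pos k).le
  set y : Fin R → ℝ := fun r => N.rho P h r * ‖h.2 r l‖ ^ 2 * ‖x r‖ ^ 2 with hy
  set T : Fin R → ℂ := fun r => x r * (Real.sqrt (N.rho P h r) : ℂ) * h.1 k r * h.2 r l *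
    (Real.sqrt (N.pS k * P) : ℂ) * ((s k : ℂ) - (s' k : ℂ)) with hT
  have hdiff : N.signalMean P x h s l - N.signalMean P x h s' l = ∑ r, T r := by
    unfold signalMean
    rw [← Finset.sum_sub_distrib, Finset.sum_eq_single k]
    · rw [← Finset.sum_sub_distrib]
      refine Finset.sum_congr rfl fun r _ => ?_
      rw [hT]
      ring
    · intro i _ hi
      rw [hss i hi, sub_self]
    · simp
  have hTr : ∀ r, R * ‖T r‖ ^ 2 = M * P * ‖h.1 k r‖ ^ 2 * y r := by
    intro r
    simp only [hT, hy, norm_mul, mul_pow, Complex.norm_real, Real.norm_eq_abs, sq_abs]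
    rw [Real.sq_sqrt (N.rho_nonneg hP h r), Real.sq_sqrt (mul_nonneg hS hP), hM]
    ring
  have hM0 : 0 ≤ M := by rw [hM]; positivity
  have hy0 : ∀ r, 0 ≤ y r := fun r =>
    mul_nonneg (mul_nonneg (N.rho_nonneg hP h r) (by positivity)) (by positivity)
  have hbound : ∀ r, M * P * ‖h.1 k r‖ ^ 2 * y r ≤ y r + 1 / R := by
    intro r
    have hR : (0 : ℝ) < R := by exact_mod_cast r.pos
    have hxr : ‖x r‖ ^ 2 ≤ 1 := by
      have := (norm_le_pi_norm x r).trans hx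
      exact pow_le_one₀ (norm_nonneg _) this
    rcases hweak r with hw | hw
    · refine (mul_le_of_le_one_left (hy0 r) hw).trans ?_
      have : (0 : ℝ) ≤ 1 / R := by positivity
      linarith
    · have h1 : M * P * ‖h.1 k r‖ ^ 2 * y r ≤
          M * P * ‖h.1 k r‖ ^ 2 * (N.rho P h r * ‖h.2 r l‖ ^ 2) := by
        refine mul_le_mul_of_nonneg_left ?_ (by positivity)
        exact mul_le_of_le_one_right (mul_nonneg (N.rho_nonneg hP h r) (by positivity)) hxr
      have h2 : M * P * ‖h.1 k r‖ ^ 2 * (N.rho P h r * ‖h.2 r l‖ ^ 2) ≤ 1 / R := by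
        rw [le_div_iff₀ hR]
        refine le_trans (le_of_eq ?_) hw
        unfold rho relayChannels
        ring
      have := hy0 r
      linarith
  rw [hdiff]
  calc ‖∑ r, T r‖ ^ 2 ≤ (∑ r, ‖T r‖) ^ 2 := by
        gcongr
        exact norm_sum_le _ _
    _ ≤ R * ∑ r, ‖T r‖ ^ 2 := by
        have := sq_sum_le_card_mul_sum_sq (s := Finset.univ) (f := fun r => ‖T r‖)
        rwa [Finset.card_univ, Fintype.card_fin] at this
    _ = ∑ r, M * P * ‖h.1 k r‖ ^ 2 * y r := by
        rw [Finset.mul_sum]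
        exact Finset.sum_congr rfl fun r _ => hTr r
    _ ≤ ∑ r, (y r + 1 / R) := Finset.sum_le_sum fun r _ => hbound r
    _ ≤ 1 + ∑ r, y r := by
        rw [Finset.sum_add_distrib, Finset.sum_const, Finset.card_univ, Fintype.card_fin,
          nsmul_eq_mul, add_comm]
        gcongr
        rw [mul_one_div]
        exact div_self_le_one _

/-- A lower bound on the probability that each relay is weak yields a lower bound on the network
error rate of every scheme. -/
theorem exists_le_NER [NeZero R] (ε : ℝ → ℝ) (hε : ∀ᶠ P in atTop, 0 ≤ ε P)
    (H : ∀ (M : ℝ), 0 < M → ∀ (k : Fin K) (l : Fin L) (r : Fin R), ∃ c : ℝ, 0 < c ∧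
      ∀ᶠ P : ℝ in atTop, ENNReal.ofReal (c * ε P) ≤ N.relayLaw r (N.weakRelay P M k l r)) :
    ∃ c : ℝ, 0 < c ∧ ∀ᶠ P : ℝ in atTop, ∀ Q : ChannelState K L R → (Fin R → ℂ),
      (∀ h, ‖Q h‖ ≤ 1) → c * ε P ^ R ≤ N.NER P Q := by
  obtain ⟨l, k, s, s', hkl, hk, hss⟩ := N.exists_symbols_pair
  have hR : (0 : ℝ) < R := by exact_mod_cast Nat.pos_of_ne_zero (NeZero.ne R)
  have hcard : (0 : ℝ) < Fintype.card N.Symbols := by exact_mod_cast Fintype.card_pos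
  have hne : N.desired l s ≠ N.desired l s' := fun heq => hk (congrFun heq ⟨k, hkl⟩)
  set M : ℝ := R * ‖(s k : ℂ) - (s' k : ℂ)‖ ^ 2 * N.pS k with hM
  have hM0 : 0 < M := by
    have h1 := N.pS_pos k
    have h2 : (s k : ℂ) - (s' k : ℂ) ≠ 0 := sub_ne_zero.2 fun h => hk (Subtype.ext h)
    positivity
  choose c hc hcP using fun r => H M hM0 k l r
  set c₀ : ℝ := Real.exp (-4) / Fintype.card N.Symbols with hc₀
  have hc₀0 : 0 < c₀ := by positivity
  refine ⟨c₀ * ∏ r, c r, mul_pos hc₀0 (Finset.prod_pos fun r _ => hc r), ?_⟩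
  filter_upwards [eventually_all.2 hcP, hε, eventually_ge_atTop (0 : ℝ)] with P hP hεP hP0 Q hQ
  set E : Set (ChannelState K L R) :=
    relayChannels ⁻¹' Set.univ.pi fun r => N.weakRelay P M k l r with hE
  have hpim : MeasurableSet (Set.univ.pi fun r => N.weakRelay P M k l r) :=
    MeasurableSet.univ_pi fun r => N.measurableSet_weakRelay P M k l r
  have hEm : MeasurableSet E := N.measurePreserving_relayChannels.measurable hpim
  have hEprob : N.channelLaw E = ∏ r, N.relayLaw r (N.weakRelay P M k l r) := by
    rw [hE, N.measurePreserving_relayChannels.measure_preimage hpim.nullMeasurableSet,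
      Measure.pi_pi]
  -- The event `E` does not depend on the quantizer, and monotonicity of the lower integral requires
  -- no measurability of `Q`.
  have hpt : ∀ h, E.indicator (fun _ => ENNReal.ofReal c₀) h ≤ N.CNER P (Q h) h := by
    intro h
    by_cases hh : h ∈ E
    · rw [Set.indicator_of_mem hh]
      exact N.le_CNER hP0 _ h l s s' hne
        (N.norm_signalMean_sub_sq_le hP0 (hQ h) h k l s s' hss hM fun r => hh r trivial)
    · rw [Set.indicator_of_notMem hh]
      exact zero_le
  unfold NER
  rw [← ENNReal.ofReal_le_iff_le_toReal
    ((N.lintegral_CNER_le_one P Q).trans_lt ENNReal.one_lt_top).ne]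
  refine le_trans ?_ (lintegral_mono hpt)
  rw [lintegral_indicator_const hEm, hEprob, mul_assoc, ENNReal.ofReal_mul hc₀0.le]
  gcongr
  have hpow : (∏ r, c r) * ε P ^ R = ∏ r, (c r * ε P) := by
    rw [Finset.prod_mul_distrib, Finset.prod_const, Finset.card_univ, Fintype.card_fin]
  rw [hpow, ENNReal.ofReal_prod_of_nonneg fun r _ => mul_nonneg (hc r).le hεP]
  exact Finset.prod_le_prod' fun r _ => hP r

/-- The first alternative suffices: `|f_k|²` falls below `1 / (M P)`. -/
theorem exists_le_relayLaw_weakRelay {M : ℝ} (hM : 0 < M) (k : Fin K) (l : Fin L) (r : Fin R) :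
    ∃ c : ℝ, 0 < c ∧ ∀ᶠ P : ℝ in atTop,
      ENNReal.ofReal (c * (1 / P)) ≤ N.relayLaw r (N.weakRelay P M k l r) := by
  have hv : (0 : ℝ) < N.varF k r := by exact_mod_cast N.varF_pos k r
  refine ⟨Real.exp (-(1 / N.varF k r)) / N.varF k r * (1 / M), by positivity, ?_⟩
  filter_upwards [eventually_ge_atTop (1 / M)] with P hP
  have hP0 : 0 < P := (by positivity : 0 < 1 / M).trans_le hP
  have hms : MeasurableSet {w : ℂ | ‖w‖ ^ 2 ≤ 1 / M * (1 / P)} :=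
    measurableSet_le (by fun_prop) measurable_const
  have hpre : (fun z : (Fin K → ℂ) × (Fin L → ℂ) => z.1 k) ⁻¹'
      {w : ℂ | ‖w‖ ^ 2 ≤ 1 / M * (1 / P)} ⊆ N.weakRelay P M k l r := by
    intro z hz
    left
    have hz' : ‖z.1 k‖ ^ 2 ≤ 1 / M * (1 / P) := hz
    calc M * P * ‖z.1 k‖ ^ 2 ≤ M * P * (1 / M * (1 / P)) := by gcongr
      _ = 1 := by field_simp
  refine le_trans ?_ (measure_mono hpre)
  have hmp : MeasurePreserving (fun z : (Fin K → ℂ) × (Fin L → ℂ) => z.1 k) (N.relayLaw r)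
      (complexNormal (N.varF k r)) :=
    (measurePreserving_eval (fun k => complexNormal (N.varF k r)) k).comp measurePreserving_fst
  rw [hmp.measure_preimage hms.nullMeasurableSet]
  refine le_trans (ENNReal.ofReal_le_ofReal (le_of_eq ?_))
    (le_complexNormal_closedBall (N.varF_pos k r) (by positivity))
  rw [min_eq_right, mul_assoc]
  rw [mul_one_div, div_le_one hP0]
  exact hP

/-- A second transmitter with `|f_k'| ≥ 1` bounds the relay gain by `pR r / pS k'`, so the second
alternative holds once `|f_k|² |g_l|² ≤ τ / P`. A product of two independent exponential variables
falls below `t` with probability of order `t log (1 / t)`. -/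
theorem exists_log_le_relayLaw_weakRelay (hK : 1 < K) {M : ℝ} (hM : 0 < M) (k : Fin K) (l : Fin L)
    (r : Fin R) :
    ∃ c : ℝ, 0 < c ∧ ∀ᶠ P : ℝ in atTop,
      ENNReal.ofReal (c * (Real.log P / P)) ≤ N.relayLaw r (N.weakRelay P M k l r) := by
  obtain ⟨k', hk'⟩ : ∃ k' : Fin K, k' ≠ k := by
    have : Nontrivial (Fin K) := Fin.nontrivial_iff_two_le.2 hK
    exact exists_ne k
  have hR : (0 : ℝ) < R := by exact_mod_cast r.pos
  have hvF : (0 : ℝ) < N.varF k r := by exact_mod_cast N.varF_pos k r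
  have hvG : (0 : ℝ) < N.varG r l := by exact_mod_cast N.varG_pos r l
  have hq := N.pR_pos r
  have hS := N.pS_pos k'
  set τ : ℝ := N.pS k' / (M * R * N.pR r) with hτ_def
  have hτ : 0 < τ := by positivity
  set δ : ℝ≥0∞ := ∏ i ∈ Finset.univ.erase k, complexNormal (N.varF i r) {w | 1 ≤ ‖w‖} with hδ_def
  have hδ : 0 < δ := by
    rw [pos_iff_ne_zero, hδ_def, Finset.prod_ne_zero_iff]
    exact fun i _ => (complexNormal_one_le_norm_pos (N.varF_pos i r)).ne'
  have hδ_top : δ ≠ ⊤ := ENNReal.prod_ne_top fun i _ => measure_ne_top _ _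
  have hδr : 0 < δ.toReal := ENNReal.toReal_pos hδ.ne' hδ_top
  set cF : ℝ := Real.exp (-(1 / N.varF k r)) / N.varF k r with hcF
  set cG : ℝ := Real.exp (-(1 / N.varG r l)) / N.varG r l with hcG
  have hcF0 : 0 < cF := by positivity
  have hcG0 : 0 < cG := by positivity
  refine ⟨δ.toReal * (cF * (cG * (τ / 2))), by positivity, ?_⟩
  filter_upwards [eventually_ge_atTop τ, eventually_ge_atTop (τ ^ 2), eventually_ge_atTop (1 : ℝ)]
    with P hP1 hP2 hP3
  have hP0 : 0 < P := zero_lt_one.trans_le hP3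
  set t : ℝ := τ / P with ht_def
  have ht : 0 < t := by positivity
  have ht1 : t ≤ 1 := (div_le_one hP0).2 hP1
  have hslice : ∀ g : Fin L → ℂ, δ * (ENNReal.ofReal cF * ENNReal.ofReal (min 1 (t / ‖g l‖ ^ 2))) ≤
      (Measure.pi fun k => complexNormal (N.varF k r))
        ((fun f => (f, g)) ⁻¹' N.weakRelay P M k l r) := by
    intro g
    set B : Fin K → Set ℂ := fun i => if i = k then {w | ‖w‖ ^ 2 ≤ t / ‖g l‖ ^ 2}
      else {w | 1 ≤ ‖w‖} with hB
    have hsub : Set.univ.pi B ⊆ (fun f => (f, g)) ⁻¹' N.weakRelay P M k l r := by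
      intro f hf
      have hfk : ‖f k‖ ^ 2 ≤ t / ‖g l‖ ^ 2 := by simpa [hB] using hf k trivial
      have hfk' : 1 ≤ ‖f k'‖ := by simpa [hB, hk'] using hf k' trivial
      right
      have hρ : (N.pR r * P) / (1 + ∑ i, ‖f i‖ ^ 2 * (N.pS i * P)) ≤ N.pR r / N.pS k' := by
        have h1 : ‖f k'‖ ^ 2 * (N.pS k' * P) ≤ ∑ i, ‖f i‖ ^ 2 * (N.pS i * P) :=
          Finset.single_le_sum (f := fun i => ‖f i‖ ^ 2 * (N.pS i * P))
            (fun i _ => mul_nonneg (by positivity) (mul_nonneg (N.pS_pos i).le hP0.le))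
            (Finset.mem_univ k')
        have h2 : N.pS k' * P ≤ ‖f k'‖ ^ 2 * (N.pS k' * P) :=
          le_mul_of_one_le_left (by positivity) (one_le_pow₀ hfk')
        rw [div_le_div_iff₀ (by linarith [mul_pos hS hP0]) hS]
        nlinarith
      have hfg : ‖f k‖ ^ 2 * ‖g l‖ ^ 2 ≤ t := by
        calc ‖f k‖ ^ 2 * ‖g l‖ ^ 2 ≤ t / ‖g l‖ ^ 2 * ‖g l‖ ^ 2 := by gcongr
          _ ≤ t := by
              -- For `g l = 0` the quotient is `0` by convention, which only shrinks the set.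
              rcases eq_or_ne (‖g l‖ ^ 2) 0 with h | h
              · rw [h, mul_zero]
                exact ht.le
              · rw [div_mul_cancel₀ _ h]
      calc M * R * P * ‖f k‖ ^ 2 * ((N.pR r * P) / (1 + ∑ i, ‖f i‖ ^ 2 * (N.pS i * P))) *
            ‖g l‖ ^ 2 ≤ M * R * P * ‖f k‖ ^ 2 * (N.pR r / N.pS k') * ‖g l‖ ^ 2 := by gcongr
        _ = M * R * P * (N.pR r / N.pS k') * (‖f k‖ ^ 2 * ‖g l‖ ^ 2) := by ring
        _ ≤ M * R * P * (N.pR r / N.pS k') * t := by gcongr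
        _ = 1 := by
            rw [ht_def, hτ_def]
            field_simp
    refine le_trans ?_ (measure_mono hsub)
    rw [Measure.pi_pi, ← Finset.mul_prod_erase Finset.univ _ (Finset.mem_univ k), mul_comm]
    refine mul_le_mul' ?_ (le_of_eq ?_)
    · rw [← ENNReal.ofReal_mul hcF0.le]
      simp only [hB, if_true]
      exact le_complexNormal_closedBall (N.varF_pos k r) (by positivity)
    · refine Finset.prod_congr rfl fun i hi => ?_
      simp only [hB, if_neg (Finset.ne_of_mem_erase hi)]
  have hmin : Measurable fun w : ℂ => ENNReal.ofReal (min 1 (t / ‖w‖ ^ 2)) := by fun_prop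
  -- Here `1 / t = P / τ`, and `P ≥ τ²` makes this at least `√P`.
  have hlog : Real.log P / 2 ≤ Real.log (1 / t) := by
    rw [ht_def, one_div_div, Real.log_div hP0.ne' hτ.ne']
    have := Real.log_le_log (by positivity) hP2
    rw [Real.log_pow] at this
    push_cast at this
    linarith
  unfold relayLaw
  rw [Measure.prod_apply_symm (N.measurableSet_weakRelay P M k l r)]
  refine le_trans ?_ (lintegral_mono hslice)
  rw [lintegral_const_mul _ (by fun_prop), lintegral_const_mul _ (by fun_prop),
    (measurePreserving_eval (fun l => complexNormal (N.varG r l)) l).lintegral_comp hmin]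
  refine le_trans ?_ (mul_le_mul_right (mul_le_mul_right
    (le_lintegral_min_one_div_sq_complexNormal (N.varG_pos r l) ht ht1) _) _)
  rw [← ENNReal.ofReal_mul hcF0.le]
  nth_rewrite 2 [← ENNReal.ofReal_toReal hδ_top]
  rw [← ENNReal.ofReal_mul hδr.le]
  refine ENNReal.ofReal_le_ofReal ?_
  calc δ.toReal * (cF * (cG * (τ / 2))) * (Real.log P / P) =
        δ.toReal * (cF * (cG * (t * (Real.log P / 2)))) := by
        rw [ht_def]
        field_simp
    _ ≤ _ := by gcongr

end RelayNetwork

/-! ### From matching bounds to diversities -/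

theorem log_mul_log_pow_div_pow {a P : ℝ} (ha : 0 < a) (hP : 1 < P) (m R : ℕ) :
    Real.log (a * (Real.log P ^ m / P ^ R)) =
      Real.log a + m * Real.log (Real.log P) - R * Real.log P := by
  have h1 : 0 < Real.log P := Real.log_pos hP
  have h2 : 0 < P := zero_lt_one.trans hP
  rw [Real.log_mul ha.ne' (by positivity), Real.log_div (by positivity) (by positivity),
    Real.log_pow, Real.log_pow]
  ring

theorem tendsto_log_log_atTop : Tendsto (fun P : ℝ => Real.log (Real.log P)) atTop atTop :=
  Real.tendsto_log_atTop.comp Real.tendsto_log_atTop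

theorem hasFirstOrderDiversity_mul_log_pow_div_pow {a : ℝ} (ha : 0 < a) (m R : ℕ) :
    HasFirstOrderDiversity (fun P => a * (Real.log P ^ m / P ^ R)) R := by
  have h1 : Tendsto (fun P : ℝ => Real.log a / Real.log P) atTop (𝓝 0) :=
    Real.tendsto_log_atTop.const_div_atTop _
  have h2 : Tendsto (fun P : ℝ => Real.log (Real.log P) / Real.log P) atTop (𝓝 0) :=
    (Real.isLittleO_log_id_atTop.tendsto_div_nhds_zero).comp Real.tendsto_log_atTop
  have h3 : Tendsto (fun P : ℝ => R - (Real.log a / Real.log P +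
      m * (Real.log (Real.log P) / Real.log P))) atTop (𝓝 (R - (0 + m * 0))) :=
    (h1.add (h2.const_mul _)).const_sub _
  rw [mul_zero, add_zero, sub_zero] at h3
  refine h3.congr' ?_
  filter_upwards [eventually_gt_atTop (1 : ℝ)] with P hP
  have := Real.log_pos hP
  rw [log_mul_log_pow_div_pow ha hP]
  field_simp
  ring

theorem hasSecondOrderDiversity_mul_log_pow_div_pow {a : ℝ} (ha : 0 < a) (m R : ℕ) :
    HasSecondOrderDiversity (fun P => a * (Real.log P ^ m / P ^ R)) R (-m) := by
  have h1 : Tendsto (fun P : ℝ => Real.log a / Real.log (Real.log P)) atTop (𝓝 0) :=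
    tendsto_log_log_atTop.const_div_atTop _
  have h3 : Tendsto (fun P : ℝ => -m - Real.log a / Real.log (Real.log P)) atTop
      (𝓝 (-m - 0)) := h1.const_sub _
  rw [sub_zero] at h3
  refine h3.congr' ?_
  filter_upwards [eventually_gt_atTop (1 : ℝ), tendsto_log_log_atTop.eventually_gt_atTop 0]
    with P hP hP'
  rw [log_mul_log_pow_div_pow ha hP]
  field_simp
  ring

/-- The first- and second-order exponents are antitone in the error rate. -/
theorem eventually_diversity_exponents_le {e e' : ℝ → ℝ} (he : ∀ᶠ P in atTop, 0 < e P)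
    (hee' : ∀ᶠ P in atTop, e P ≤ e' P) (d : ℝ) : ∀ᶠ P in atTop,
      -(Real.log (e' P) / Real.log P) ≤ -(Real.log (e P) / Real.log P) ∧
      -((Real.log (e' P) + d * Real.log P) / Real.log (Real.log P)) ≤
        -((Real.log (e P) + d * Real.log P) / Real.log (Real.log P)) := by
  filter_upwards [he, hee', eventually_gt_atTop (1 : ℝ),
    tendsto_log_log_atTop.eventually_gt_atTop 0] with P h1 h2 h3 h4
  have h5 := Real.log_pos h3
  have h6 := Real.log_le_log h1 h2
  constructor <;> gcongr

/-- Multiplicative constants disappear in both exponents, so matching bounds squeeze those of `Q`,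
while the universal lower bound caps those of any competitor. -/
theorem RelayNetwork.attainsMaximalDiversity_of_bounds {K L R : ℕ} [NeZero R]
    (N : RelayNetwork K L R) (Q : ℝ → ChannelState K L R → (Fin R → ℂ))
    (hQ : ∀ P h, ‖Q P h‖ ≤ 1) (m : ℕ) {c C : ℝ} (hc : 0 < c) (hC : 0 < C)
    (hupper : ∀ᶠ P : ℝ in atTop, N.NER P (Q P) ≤ C * (Real.log P ^ m / P ^ R))
    (hlower : ∀ᶠ P : ℝ in atTop, ∀ Q' : ChannelState K L R → (Fin R → ℂ),
      (∀ h, ‖Q' h‖ ≤ 1) → c * (Real.log P ^ m / P ^ R) ≤ N.NER P Q') :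
    N.AttainsMaximalDiversity Q R (-m) := by
  have hpos : ∀ᶠ P : ℝ in atTop, 0 < c * (Real.log P ^ m / P ^ R) := by
    filter_upwards [eventually_gt_atTop (1 : ℝ)] with P hP
    have := Real.log_pos hP
    positivity
  have hlow : ∀ Q' : ℝ → ChannelState K L R → (Fin R → ℂ), (∀ P h, ‖Q' P h‖ ≤ 1) →
      ∀ᶠ P : ℝ in atTop, c * (Real.log P ^ m / P ^ R) ≤ N.NER P (Q' P) := fun Q' hQ' =>
    hlower.mono fun P hP => hP (Q' P) (hQ' P)
  have hpos' : ∀ᶠ P : ℝ in atTop, 0 < N.NER P (Q P) := by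
    filter_upwards [hpos, hlow Q hQ] with P h1 h2 using h1.trans_le h2
  have hup := eventually_diversity_exponents_le hpos' hupper R
  have hdown := eventually_diversity_exponents_le hpos (hlow Q hQ) R
  refine ⟨?_, ?_, fun Q' hQ' d₁' hd₁' => ⟨?_, fun heq d₂' hd₂' => ?_⟩⟩
  · exact tendsto_of_tendsto_of_tendsto_of_le_of_le'
      (hasFirstOrderDiversity_mul_log_pow_div_pow hC m R)
      (hasFirstOrderDiversity_mul_log_pow_div_pow hc m R)
      (hup.mono fun P h => h.1) (hdown.mono fun P h => h.1)
  · exact tendsto_of_tendsto_of_tendsto_of_le_of_le'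
      (hasSecondOrderDiversity_mul_log_pow_div_pow hC m R)
      (hasSecondOrderDiversity_mul_log_pow_div_pow hc m R)
      (hup.mono fun P h => h.2) (hdown.mono fun P h => h.2)
  · exact le_of_tendsto_of_tendsto hd₁' (hasFirstOrderDiversity_mul_log_pow_div_pow hc m R)
      ((eventually_diversity_exponents_le hpos (hlow Q' hQ') R).mono fun P h => h.1)
  · subst heq
    exact le_of_tendsto_of_tendsto hd₂' (hasSecondOrderDiversity_mul_log_pow_div_pow hc m R)
      ((eventually_diversity_exponents_le hpos (hlow Q' hQ') R).mono fun P h => h.2)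

theorem RelayNetwork.norm_GQ_le {K L R : ℕ} [NeZero R] (N : RelayNetwork K L R) (P : ℝ)
    (h : ChannelState K L R) : ‖N.GQ P h‖ ≤ 1 := by
  unfold GQ relayVector
  rw [Pi.norm_single, norm_one]

end

theorem theorem2 {K L R : ℕ} [NeZero R] (N : RelayNetwork K L R) :
    (K = 1 →
      (∃ C₃ : ℝ, 0 < C₃ ∧ ∀ᶠ P : ℝ in atTop, N.NER P (N.GQ P) ≤ C₃ * (1 / P ^ R)) ∧
      N.AttainsMaximalDiversity N.GQ R 0) ∧
    (1 < K →
      (∃ C₄ : ℝ, 0 < C₄ ∧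
        ∀ᶠ P : ℝ in atTop, N.NER P (N.GQ P) ≤ C₄ * (Real.log P ^ R / P ^ R)) ∧
      N.AttainsMaximalDiversity N.GQ R (-(R : ℝ))) := by
  constructor
  · rintro rfl
    have hε : ∀ᶠ P : ℝ in atTop, 0 ≤ 1 / P :=
      (eventually_ge_atTop (0 : ℝ)).mono fun P hP => one_div_nonneg.2 hP
    obtain ⟨C, hC, hup⟩ := N.exists_NER_GQ_le (fun P => 1 / P) hε
      fun r l p => N.exists_lintegral_exp_relaySNR_le_of_one r l p
    obtain ⟨c, hc, hlow⟩ := N.exists_le_NER (fun P => 1 / P) hε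
      fun M hM k l r => N.exists_le_relayLaw_weakRelay hM k l r
    simp only [one_div_pow] at hup hlow
    refine ⟨⟨C, hC, hup⟩, ?_⟩
    -- With `m = 0` the logarithmic factor is `1`, hence second-order diversity `0`.
    have := N.attainsMaximalDiversity_of_bounds N.GQ N.norm_GQ_le 0 hc hC
      (by simpa using hup) (by simpa using hlow)
    simpa using this
  · intro hK
    have hε : ∀ᶠ P : ℝ in atTop, 0 ≤ Real.log P / P :=
      (eventually_ge_atTop (1 : ℝ)).mono fun P hP =>
        div_nonneg (Real.log_nonneg hP) (zero_le_one.trans hP)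
    obtain ⟨C, hC, hup⟩ := N.exists_NER_GQ_le (fun P => Real.log P / P) hε
      fun r l p => N.exists_lintegral_exp_relaySNR_le r l p
    obtain ⟨c, hc, hlow⟩ := N.exists_le_NER (fun P => Real.log P / P) hε
      fun M hM k l r => N.exists_log_le_relayLaw_weakRelay hK hM k l r
    simp only [div_pow] at hup hlow
    exact ⟨⟨C, hC, hup⟩,
      N.attainsMaximalDiversity_of_bounds N.GQ N.norm_GQ_le R hc hC hup hlow⟩
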